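/- Let $0<a<b<\infty$ and let $\pi_1$ be a probability density with respect to Lebesgue measure on $\mathbb{R}_+$. Put $\pi_t(x)=t^{-1}\pi_1(x/t)$ for $t,x>0$ and, for a probability density $f$ on $(0,\infty)$, let $\pi_f$ be the scale mixture with density $\pi_f(x)=\int_0^\infty f(t)\,\pi_t(x)\,dt$ on $\mathbb{R}_+$; $\pi_f^{\otimes n}$ denotes the expectation under the law of an i.i.d. sample of size $n$ from $\pi_f$. Let $\mathbb{H}=L^2([a,b])$ and let $\mathcal{S}_n$ be the set of all Borel functions from $\mathbb{R}^n$ to $\mathbb{H}$. Let $$\phi(\xi)=\int_{\mathbb{R}} e^{t+i\xi t}\,\pi_1(e^t)\,dt ,\qquad \xi\in\mathbb{R},$$ be the characteristic function of $\log Y$, where $Y$ has density $\pi_1$. For a function $g$ on $\mathbb{R}$ put $\tilde T(g)(t)=t^{-1}g(\log t)$, $t\in(0,\infty)$. For $\alpha>0$ and $C>0$ let $\mathcal{L}(\alpha,C)$ be the set of all probability densities $g$ on $\mathbb{R}$ that are $r$ times differentiable and satisfy $|g^{(r)}(t)-g^{(r)}(u)|\le C|t-u|^{\alpha-r}$ for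 all $t,u\in\mathbb{R}$, where $r=[\alpha]$ is the integer part of $\alpha$. (a) Let $\beta\in\mathbb{R}$ with $2(\alpha+\beta)+1>0$ (for instance $\beta\ge 0$). Assume that $\phi$ is twice differentiable at all $t$ with $|t|$ sufficiently large and that $\phi^{(j)}(t)=O(|t|^{-\beta-j})$ as $|t|\to\infty$ for $j=0,1,2$. Then there exists $C^*>0$ such that, as $n\to\infty$, $$\inf_{\hat f\in\mathcal{S}_n}\ \sup_{f\in\tilde T(\mathcal{L}(\alpha,C))}\pi_f^{\otimes n}\|\hat f-f\|_{\mathbb{H}}^2\ \ge\ C^*\,n^{-2\alpha/(2(\alpha+\beta)+1)}\,(1+o(1)).$$ (b) Assume that $\phi(t)=O(|t|^{\beta_1}e^{-|t|^\beta/\gamma})$ as $|t|\to\infty$ for some $\beta,\gamma>0$ and $\beta_1\in\mathbb{R}$, and that $\pi_1(u)=o(u^{-1}|\log u|^{-\kappa})$ as $u\to0$ and as $u\to\infty$, for some $\kappa>1$. Then there exists $C^*>0$ such that, as $n\to\infty$, $$\inf_{\hat f\in\mathcal{S}_n}\ \sup_{f\in\tilde T(\mathcal{L}(\alpha,C))}\pi_f^{\otimes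 n}\|\hat f-f\|_{\mathbb{H}}^2\ \ge\ C^*\,(\log n)^{-2\alpha/\beta}\,(1+o(1)).$$ In both parts $C^*$ may depend on $a,b,\pi_1,\alpha,C$ and on the constants in the assumptions, but not on $n$. -/

import Mathlib

open MeasureTheory Filter Topology Set Asymptotics
open scoped ENNReal

noncomputable section

/-- `p` is a probability density with respect to Lebesgue measure on `ℝ₊`.
(Only the values of `p` on `(0, ∞)` are relevant.) -/
structure IsDensityOnPos (p : ℝ → ℝ) : Prop where
  measurable : Measurable p
  nonneg : ∀ x, 0 < x → 0 ≤ p x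
  lintegral_eq_one : ∫⁻ x in Ioi (0 : ℝ), ENNReal.ofReal (p x) = 1

/-- The scale family `π_t(x) = t⁻¹ π₁(x / t)`. -/
def scaleFamily (p : ℝ → ℝ) (t x : ℝ) : ℝ := t⁻¹ * p (x / t)

/-- The mixture density `π_f(x) = ∫_{(0,∞)} f(t) π_t(x) dt` of the scale family of `p`, with
mixing density `f` on `(0, ∞)` (as an integral of a nonnegative function). -/
def mixtureDensity (p f : ℝ → ℝ) (x : ℝ) : ℝ≥0∞ :=
  ∫⁻ t in Ioi (0 : ℝ), ENNReal.ofReal (f t * scaleFamily p t x)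

/-- The mixture distribution: the measure with density `π_f` with respect to Lebesgue measure
on `ℝ₊`. It is the law of `θ Y`, with independent `θ` of density `f` and `Y` of density `p`. -/
def mixtureMeasure (p f : ℝ → ℝ) : Measure ℝ :=
  (volume.restrict (Ioi (0 : ℝ))).withDensity (mixtureDensity p f)

/-- The characteristic function of the density `t ↦ e^t π₁(e^t)` of `log Y`:
`φ(ξ) = ∫ e^{t + iξt} π₁(e^t) dt`. -/
def logCharFun (p : ℝ → ℝ) (ξ : ℝ) : ℂ :=
  ∫ t : ℝ, Complex.exp ((t : ℂ) + Complex.I * (ξ : ℂ) * (t : ℂ)) * ((p (Real.exp t) : ℝ) : ℂ)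

/-- The class `𝓛(α, C)` of probability densities `g` on `ℝ` that are `r` times differentiable
and satisfy `|g^{(r)}(t) - g^{(r)}(u)| ≤ C |t - u|^{α - r}` for all `t, u`, where `r` is the
integer part of `α`. -/
def holderDensities (α C : ℝ) : Set (ℝ → ℝ) :=
  {g | (∀ t, 0 ≤ g t) ∧ Integrable g ∧ ∫ t, g t = 1 ∧
    (∀ k < ⌊α⌋₊, Differentiable ℝ (iteratedDeriv k g)) ∧
    ∀ t u : ℝ, |iteratedDeriv ⌊α⌋₊ g t - iteratedDeriv ⌊α⌋₊ g u|
      ≤ C * |t - u| ^ (α - (⌊α⌋₊ : ℝ))}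

/-- The operator `T̃(g)(t) = t⁻¹ g(log t)`, `t ∈ (0, ∞)`. -/
def expTransform (g : ℝ → ℝ) (t : ℝ) : ℝ := t⁻¹ * g (Real.log t)

/-- The set `𝓢_n` of all estimators based on `n` observations: the Borel functions from `ℝⁿ`
to the Hilbert space `L²[a, b]`. -/
def estimators (a b : ℝ) (n : ℕ) :
    Set ((Fin n → ℝ) → Lp ℝ 2 (volume.restrict (Icc a b))) :=
  {fhat | @Measurable (Fin n → ℝ) (Lp ℝ 2 (volume.restrict (Icc a b))) _ (borel _) fhat}

/-- The mean integrated squared error `π_f^{⊗ n} ‖fhat - f‖²`, with the norm of `L²[a, b]`. -/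
def mise (a b : ℝ) (p : ℝ → ℝ) (n : ℕ)
    (fhat : (Fin n → ℝ) → Lp ℝ 2 (volume.restrict (Icc a b))) (f : ℝ → ℝ) : ℝ≥0∞ :=
  ∫⁻ x, (eLpNorm (fun t => (fhat x : ℝ → ℝ) t - f t) 2 (volume.restrict (Icc a b))) ^ 2
    ∂(Measure.pi fun _ : Fin n => mixtureMeasure p f)

/-- The minimax risk `inf_{fhat ∈ 𝓢_n} sup_{f ∈ F} π_f^{⊗ n} ‖fhat - f‖²` over the class `F`. -/
def minimaxRisk (a b : ℝ) (p : ℝ → ℝ) (F : Set (ℝ → ℝ)) (n : ℕ) : ℝ≥0∞ :=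
  ⨅ fhat ∈ estimators a b n, ⨆ f ∈ F, mise a b p n fhat f

end

/-!
Taking logarithms turns the scale mixture into a deconvolution problem: if `g` is the density of
`log θ`, the logarithm of an observation has density `g * q` (`logMixture`), where
`q(u) = e^u p(e^u)` (`logDensity`) has characteristic function `φ` (`logCharFun_eq`), and an
estimator has to recover `g(log t) / t` on `[a, b]`.

A heavy-tailed density `g` of the class, with tail `(1 + x²)^(-s)`, `1/2 < s ≤ 1`, is perturbed by
any subset of `m` bumps `c τ^(-α) ψ(τ (x - x₀) - j)`, `j < m`, where `τ = m / (log b - log a)` and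
`x₀ = log a`. The factor `τ^(-α)` keeps the Hölder constants bounded
(`abs_iteratedDeriv_sub_le_of_scale`), and the decay of the Schwartz function `ψ` keeps the sums
below `g / 2` (`exists_perturbation_small`), so that all `2^m` vertices of this cube belong to the
class. Switching one bump on or off changes the mixing density by a squared `L²` norm of order
`τ^(-2α-1)` on an interval belonging to that bump, hence Assouad's lemma
(`assouad_le_minimaxRisk`) bounds the risk below by a multiple of `m τ^(-2α-1) ≍ τ^(-2α)`, provided
that the `χ²`-divergence between neighbouring vertices is at most `1 / n`. As `g * q` is at least a
multiple of `(1 + y²)^(-s)` (`IsDensityOnPos.exists_le_logMixture`), that divergence is at most a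
constant times `τ^(-2α) ∫ |ψ(τ ·) * q|² (1 + y²)^s` (`blurredSize`,
`exists_le_minimaxRisk_of_blurredSize_le`).

The bump `ψ` (`oscBump`) is chosen with Fourier transform supported away from the origin, so that
only the values of `φ` at frequencies of order `τ` enter: `ψ(τ ·) * q` is, up to rescaling, the real
part of the Fourier transform of `v ↦ η(v) φ(2π τ v)` with `η` supported in `[1, 2]`
(`IsDensityOnPos.logMixture_oscBump`). In the polynomial case take `s = 1`; two integrations by
parts give the pointwise bound `τ^(-β) (1 + (τ z)²)⁻¹`, and the integral is at most of order `τ^(-2β-1)`. In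
the exponential case `ψ(τ ·) * q` is uniformly of size `exp (-c τ^β)`, whereas the tail of `q` only
gives decay `|z|^(-κ)` in `z`. Interpolating between the two bounds retains a positive fraction of
the exponential decay, and the weighted integral converges because `s > 1/2` may be taken close
enough to `1/2` for `κ > 1`. It remains to take `τ` of order `n^(1/(2(α+β)+1))` and
`(log n)^(1/β)`, respectively.
-/

/-! ### Testing two product measures -/

section Testing

variable {Ω : Type*} [MeasurableSpace Ω]

theorem lintegral_pi_prod {n : ℕ} (P : Measure Ω) [IsProbabilityMeasure P] (F : Fin n → Ω → ℝ≥0∞)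
    (hF : ∀ i, Measurable (F i)) :
    ∫⁻ x, ∏ i, F i (x i) ∂(Measure.pi fun _ : Fin n => P) = ∏ i, ∫⁻ y, F i y ∂P := by
  rw [ProbabilityTheory.lintegral_prod_eq_prod_lintegral_of_indepFun Finset.univ
    (fun i (x : Fin n → Ω) => F i (x i))
    (ProbabilityTheory.iIndepFun_pi (μ := fun _ : Fin n => P)
      fun i => (hF i).aemeasurable)
    (fun i => (hF i).comp (measurable_pi_apply i))]
  refine Finset.prod_congr rfl fun i _ => ?_
  exact (measurePreserving_eval (fun _ : Fin n => P) i).lintegral_comp (hF i)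

theorem pi_withDensity_prod {n : ℕ} (P : Measure Ω) [IsProbabilityMeasure P] (ℓ : Ω → ℝ≥0∞)
    (hℓ : Measurable ℓ) [IsProbabilityMeasure (P.withDensity ℓ)] :
    Measure.pi (fun _ : Fin n => P.withDensity ℓ)
      = (Measure.pi fun _ : Fin n => P).withDensity fun x => ∏ i, ℓ (x i) := by
  refine Measure.pi_eq fun s hs => ?_
  rw [withDensity_apply _ (MeasurableSet.univ_pi hs), ← lintegral_indicator (MeasurableSet.univ_pi hs)]
  have : (Set.univ.pi s).indicator (fun x : Fin n → Ω => ∏ i, ℓ (x i))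
      = fun x => ∏ i, (s i).indicator ℓ (x i) := by
    funext x
    by_cases hx : x ∈ Set.univ.pi s
    · rw [indicator_of_mem hx]
      exact Finset.prod_congr rfl fun i _ => (indicator_of_mem (hx i (mem_univ i)) _).symm
    · rw [indicator_of_notMem hx]
      simp only [mem_univ_pi, not_forall] at hx
      obtain ⟨i, hi⟩ := hx
      exact (Finset.prod_eq_zero (Finset.mem_univ i) (indicator_of_notMem hi _)).symm
  rw [this, lintegral_pi_prod P _ fun i => hℓ.indicator (hs i)]
  refine Finset.prod_congr rfl fun i _ => ?_
  rw [lintegral_indicator (hs i), withDensity_apply _ (hs i)]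

/-- For `ℓ > 1` this is `(ℓ / 2 - 1) ^ 2 ≥ 0`. It trades the total variation distance for the
second moment of the likelihood ratio. -/
theorem ENNReal.le_min_one_add_sq_div_four (l : ℝ≥0∞) : l ≤ min 1 l + l ^ 2 / 4 := by
  by_cases hl : l = ∞
  · rw [hl]; simp [ENNReal.top_div]
  lift l to NNReal using hl
  by_cases h1 : l ≤ 1
  · rw [min_eq_right (by exact_mod_cast h1)]
    exact le_self_add
  · rw [min_eq_left (by exact_mod_cast (not_le.mp h1).le)]
    have : l ≤ 1 + l ^ 2 / 4 := by
      rw [← NNReal.coe_le_coe]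
      push_cast
      nlinarith [sq_nonneg ((l : ℝ) / 2 - 1)]
    have h4 : ((4 : NNReal) : ℝ≥0∞) = 4 := rfl
    rw [← h4, ← ENNReal.coe_pow, ← ENNReal.coe_div (by norm_num)]
    exact_mod_cast this

theorem ENNReal.one_add_inv_natCast_pow_le (n : ℕ) (hn : 0 < n) :
    (1 + (n : ℝ≥0∞)⁻¹) ^ n ≤ 3 := by
  have hn' : (0 : ℝ) < n := by exact_mod_cast hn
  have h0 : (1 + (n : ℝ≥0∞)⁻¹) = ENNReal.ofReal (1 + (n : ℝ)⁻¹) := by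
    rw [ENNReal.ofReal_add zero_le_one (by positivity), ENNReal.ofReal_one,
      ENNReal.ofReal_inv_of_pos hn', ENNReal.ofReal_natCast]
  rw [h0, ← ENNReal.ofReal_pow (by positivity)]
  have h3 : (3 : ℝ≥0∞) = ENNReal.ofReal 3 := by norm_num
  rw [h3]
  refine ENNReal.ofReal_le_ofReal ?_
  calc (1 + (n : ℝ)⁻¹) ^ n ≤ (Real.exp ((n : ℝ)⁻¹)) ^ n := by
        gcongr; rw [add_comm]; exact Real.add_one_le_exp _
    _ = Real.exp 1 := by rw [← Real.exp_nat_mul, mul_inv_cancel₀ hn'.ne']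
    _ ≤ 3 := by linarith [Real.exp_one_lt_d9]

/-- Two hypotheses whose `χ²`-divergence is at most `1 / n` cannot be told apart from `n`
observations: if two losses add up to at least `D` at every sample point, then one of the two
mean losses is of the order of `D`. -/
theorem le_lintegral_add_lintegral_of_chiSq {n : ℕ} (hn : 0 < n) (P Q : Measure Ω)
    [IsProbabilityMeasure P] [IsProbabilityMeasure Q] (ℓ : Ω → ℝ≥0∞) (hℓ : Measurable ℓ)
    (hQ : Q = P.withDensity ℓ) (hchi : ∫⁻ x, ℓ x ^ 2 ∂P ≤ 1 + (n : ℝ≥0∞)⁻¹)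
    (A B : (Fin n → Ω) → ℝ≥0∞) (hA : Measurable A) (hB : Measurable B) (D : ℝ≥0∞)
    (hAB : ∀ x, D ≤ A x + B x) :
    D / 4 ≤ (∫⁻ x, A x ∂(Measure.pi fun _ : Fin n => P))
      + ∫⁻ x, B x ∂(Measure.pi fun _ : Fin n => Q) := by
  subst hQ
  set Λ : (Fin n → Ω) → ℝ≥0∞ := fun x => ∏ i, ℓ (x i) with hΛ
  have hΛm : Measurable Λ :=
    Finset.measurable_prod _ fun i _ => hℓ.comp (measurable_pi_apply i)
  rw [pi_withDensity_prod P ℓ hℓ, lintegral_withDensity_eq_lintegral_mul _ hΛm hB,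
    ← lintegral_add_left hA]
  have h1 : ∫⁻ x, Λ x ∂(Measure.pi fun _ : Fin n => P) = 1 := by
    have h := congrArg (fun μ => μ univ) (pi_withDensity_prod (n := n) P ℓ hℓ)
    simp only [measure_univ, withDensity_apply _ MeasurableSet.univ, Measure.restrict_univ] at h
    exact h.symm
  have h2 : ∫⁻ x, Λ x ^ 2 ∂(Measure.pi fun _ : Fin n => P) ≤ 3 := by
    simp only [hΛ, ← Finset.prod_pow]
    rw [lintegral_pi_prod P (fun _ y => ℓ y ^ 2) fun _ => hℓ.pow_const 2, Finset.prod_const,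
      Finset.card_univ, Fintype.card_fin]
    exact (pow_le_pow_left' hchi n).trans (ENNReal.one_add_inv_natCast_pow_le n hn)
  set μ := Measure.pi fun _ : Fin n => P
  have h3 : (1 : ℝ≥0∞) ≤ (∫⁻ x, min 1 (Λ x) ∂μ) + 3 / 4 := by
    calc (1 : ℝ≥0∞) = ∫⁻ x, Λ x ∂μ := h1.symm
      _ ≤ ∫⁻ x, (min 1 (Λ x) + Λ x ^ 2 / 4) ∂μ :=
        lintegral_mono fun x => ENNReal.le_min_one_add_sq_div_four _
      _ = (∫⁻ x, min 1 (Λ x) ∂μ) + (∫⁻ x, Λ x ^ 2 ∂μ) / 4 := by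
        rw [lintegral_add_left (measurable_const.min hΛm)]
        simp_rw [div_eq_mul_inv]
        rw [lintegral_mul_const _ (hΛm.pow_const 2)]
      _ ≤ _ := by gcongr
  have h4 : (1 : ℝ≥0∞) / 4 ≤ ∫⁻ x, min 1 (Λ x) ∂μ := by
    have : (1 : ℝ≥0∞) / 4 + 3 / 4 = 1 := by
      rw [← ENNReal.add_div]
      norm_num
      exact ENNReal.div_self (by norm_num) (by norm_num)
    have h34 : (3 : ℝ≥0∞) / 4 ≠ ∞ := ENNReal.div_ne_top (by norm_num) (by norm_num)
    exact (ENNReal.add_le_add_iff_right h34).1 (this.le.trans h3)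
  calc D / 4 = D * (1 / 4) := by rw [mul_one_div]
    _ ≤ D * ∫⁻ x, min 1 (Λ x) ∂μ := by gcongr
    _ = ∫⁻ x, D * min 1 (Λ x) ∂μ := (lintegral_const_mul _ (measurable_const.min hΛm)).symm
    _ ≤ _ := by
      refine lintegral_mono fun x => ?_
      calc D * min 1 (Λ x) ≤ (A x + B x) * min 1 (Λ x) := by gcongr; exact hAB x
        _ = A x * min 1 (Λ x) + B x * min 1 (Λ x) := add_mul _ _ _
        _ ≤ A x * 1 + B x * Λ x := by gcongr; exacts [min_le_left _ _, min_le_right _ _]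
        _ = _ := by simp [mul_comm]

end Testing

/-! ### Reduction of the minimax risk to two-point problems on a cube -/

theorem continuous_eLpNorm_sub_restrict {a b : ℝ} (f : ℝ → ℝ) (hf : Measurable f) (J : Set ℝ)
    (hJ : J ⊆ Icc a b) :
    Continuous fun u : Lp ℝ 2 (volume.restrict (Icc a b)) =>
      eLpNorm (fun t => (u : ℝ → ℝ) t - f t) 2 (volume.restrict J) := by
  have hle : volume.restrict J ≤ volume.restrict (Icc a b) := Measure.restrict_mono hJ le_rfl
  refine continuous_of_le_add_edist 1 ENNReal.one_ne_top fun u v => ?_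
  have hu := (Lp.aestronglyMeasurable u).mono_measure hle
  have hv := (Lp.aestronglyMeasurable v).mono_measure hle
  have hfm := hf.aestronglyMeasurable (μ := volume.restrict J)
  have h : (fun t => (u : ℝ → ℝ) t - f t)
      = (fun t => (v : ℝ → ℝ) t - f t) + fun t => (u : ℝ → ℝ) t - (v : ℝ → ℝ) t := by
    funext t; simp
  rw [h, one_mul]
  refine (eLpNorm_add_le (hv.sub hfm) (hu.sub hv) (by norm_num)).trans (add_le_add_right ?_ _)
  rw [Lp.edist_def]
  exact eLpNorm_mono_measure _ hle

theorem eLpNorm_two_sq_eq_lintegral (h : ℝ → ℝ) (μ : Measure ℝ) :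
    eLpNorm h 2 μ ^ 2 = ∫⁻ t, ‖h t‖ₑ ^ 2 ∂μ := by
  have := eLpNorm_nnreal_pow_eq_lintegral (f := h) (μ := μ) (p := 2) two_ne_zero
  simpa using this

theorem sum_eLpNorm_sq_restrict_le {m : ℕ} (h : ℝ → ℝ) (S : Set ℝ) (J : Fin m → Set ℝ)
    (hJm : ∀ j, MeasurableSet (J j)) (hJd : Pairwise fun i j => Disjoint (J i) (J j))
    (hJ : ∀ j, J j ⊆ S) :
    ∑ j, eLpNorm h 2 (volume.restrict (J j)) ^ 2 ≤ eLpNorm h 2 (volume.restrict S) ^ 2 := by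
  simp_rw [eLpNorm_two_sq_eq_lintegral]
  calc ∑ j, ∫⁻ t in J j, ‖h t‖ₑ ^ 2 = ∫⁻ t in ⋃ j, J j, ‖h t‖ₑ ^ 2 := by
        rw [lintegral_iUnion hJm hJd, tsum_fintype]
    _ ≤ _ := lintegral_mono_set (iUnion_subset hJ)

/-- The vertex of the cube obtained from `e` by flipping its `j`-th bit. -/
def flipBit {m : ℕ} (j : Fin m) (e : Fin m → Bool) : Fin m → Bool := Function.update e j (!e j)

theorem flipBit_involutive {m : ℕ} (j : Fin m) : Function.Involutive (flipBit j) := by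
  intro e
  simp [flipBit]

theorem flipBit_apply_self {m : ℕ} (j : Fin m) (e : Fin m → Bool) : flipBit j e j = !e j := by
  simp [flipBit]

theorem flipBit_apply_of_ne {m : ℕ} {i j : Fin m} (h : i ≠ j) (e : Fin m → Bool) :
    flipBit j e i = e i := by
  simp [flipBit, h]

/-- **Assouad's lemma** for the mean integrated squared error. The loss of an estimator on
`[a, b]` dominates the sum of its losses on the disjoint sets `J j`; on `J j` the estimator has
to decide between vertices of the cube that differ in the `j`-th bit. -/
theorem assouad_le_minimaxRisk {a b : ℝ} {p : ℝ → ℝ} {F : Set (ℝ → ℝ)} {m n : ℕ} (hn : 0 < n)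
    (f : (Fin m → Bool) → ℝ → ℝ) (hf : ∀ e, f e ∈ F) (hfm : ∀ e, Measurable (f e))
    (J : Fin m → Set ℝ) (hJm : ∀ j, MeasurableSet (J j))
    (hJd : Pairwise fun i j => Disjoint (J i) (J j)) (hJ : ∀ j, J j ⊆ Icc a b)
    (D : ℝ≥0∞)
    (hsep : ∀ e j, D ≤
      eLpNorm (fun t => f e t - f (flipBit j e) t) 2 (volume.restrict (J j)) ^ 2)
    (hprob : ∀ e, IsProbabilityMeasure (mixtureMeasure p (f e)))
    (hchi : ∀ e j, ∃ ℓ : ℝ → ℝ≥0∞, Measurable ℓ ∧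
      mixtureMeasure p (f (flipBit j e)) = (mixtureMeasure p (f e)).withDensity ℓ ∧
      ∫⁻ x, ℓ x ^ 2 ∂(mixtureMeasure p (f e)) ≤ 1 + (n : ℝ≥0∞)⁻¹) :
    m * (D / 16) ≤ minimaxRisk a b p F n := by
  refine le_iInf₂ fun fhat hfhat => ?_
  set S := ⨆ g ∈ F, mise a b p n fhat g with hS
  set R : (Fin m → Bool) → Fin m → ℝ≥0∞ := fun e j =>
    ∫⁻ x, eLpNorm (fun t => (fhat x : ℝ → ℝ) t - f e t) 2 (volume.restrict (J j)) ^ 2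
      ∂(Measure.pi fun _ : Fin n => mixtureMeasure p (f e)) with hR
  have hmeas : ∀ e j, Measurable fun x =>
      eLpNorm (fun t => (fhat x : ℝ → ℝ) t - f e t) 2 (volume.restrict (J j)) ^ 2 := by
    intro e j
    have hc := (ENNReal.continuous_pow 2).comp
      (continuous_eLpNorm_sub_restrict (f e) (hfm e) (J j) (hJ j))
    let _ : MeasurableSpace (Lp ℝ 2 (volume.restrict (Icc a b))) := borel _
    have : BorelSpace (Lp ℝ 2 (volume.restrict (Icc a b))) := ⟨rfl⟩
    exact hc.measurable.comp (show Measurable fhat from hfhat)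
  have hloc : ∀ e, ∑ j, R e j ≤ S := by
    intro e
    refine le_trans ?_ (le_iSup₂ (f := fun g (_ : g ∈ F) => mise a b p n fhat g) (f e) (hf e))
    rw [hR, ← lintegral_finsetSum _ fun j _ => hmeas e j]
    exact lintegral_mono fun x => sum_eLpNorm_sq_restrict_le _ _ J hJm hJd hJ
  have hpair : ∀ e j, D / 8 ≤ R e j + R (flipBit j e) j := by
    intro e j
    obtain ⟨ℓ, hℓ, hQ, hc⟩ := hchi e j
    have := hprob e
    have := hprob (flipBit j e)
    have h8 : D / 8 = D / 2 / 4 := by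
      rw [div_eq_mul_inv, div_eq_mul_inv, div_eq_mul_inv, mul_assoc,
        ← ENNReal.mul_inv (by simp) (by simp)]
      norm_num
    rw [h8]
    refine le_lintegral_add_lintegral_of_chiSq hn _ _ ℓ hℓ hQ hc _ _ (hmeas e j)
      (hmeas (flipBit j e) j) (D / 2) fun x => ?_
    set X := eLpNorm (fun t => (fhat x : ℝ → ℝ) t - f e t) 2 (volume.restrict (J j))
    set Y := eLpNorm (fun t => (fhat x : ℝ → ℝ) t - f (flipBit j e) t) 2 (volume.restrict (J j))
    have hle : volume.restrict (J j) ≤ volume.restrict (Icc a b) :=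
      Measure.restrict_mono (hJ j) le_rfl
    have hu := (Lp.aestronglyMeasurable (fhat x)).mono_measure hle
    have htri : eLpNorm (fun t => f e t - f (flipBit j e) t) 2 (volume.restrict (J j)) ≤ Y + X := by
      have : (fun t => f e t - f (flipBit j e) t)
          = (fun t => (fhat x : ℝ → ℝ) t - f (flipBit j e) t)
            - fun t => (fhat x : ℝ → ℝ) t - f e t := by
        funext t; simp
      rw [this]
      exact eLpNorm_sub_le (hu.sub (hfm _).aestronglyMeasurable)
        (hu.sub (hfm _).aestronglyMeasurable) (by norm_num)
    have hsq : (Y + X) ^ 2 ≤ 2 * (Y ^ 2 + X ^ 2) := by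
      have := ENNReal.rpow_add_le_mul_rpow_add_rpow Y X (p := 2) (by norm_num)
      norm_num at this
      exact_mod_cast this
    rw [ENNReal.div_le_iff (by simp) (by simp)]
    calc D ≤ _ := hsep e j
      _ ≤ (Y + X) ^ 2 := by gcongr
      _ ≤ 2 * (Y ^ 2 + X ^ 2) := hsq
      _ = _ := by ring
  have hsum : ∀ j, ∑ e, R (flipBit j e) j = ∑ e, R e j := fun j =>
    Equiv.sum_comp (flipBit_involutive j).toPerm fun e => R e j
  have hcol : ∀ j, (Fintype.card (Fin m → Bool) : ℝ≥0∞) * (D / 16) ≤ ∑ e, R e j := by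
    intro j
    have h1 : (Fintype.card (Fin m → Bool) : ℝ≥0∞) * (D / 8) ≤ 2 * ∑ e, R e j := by
      calc (Fintype.card (Fin m → Bool) : ℝ≥0∞) * (D / 8)
          = ∑ _e : Fin m → Bool, D / 8 := by
            rw [Finset.sum_const, nsmul_eq_mul, Finset.card_univ]
        _ ≤ ∑ e, (R e j + R (flipBit j e) j) := Finset.sum_le_sum fun e _ => hpair e j
        _ = 2 * ∑ e, R e j := by rw [Finset.sum_add_distrib, hsum j, two_mul]
    have h2 : (2 : ℝ≥0∞) * (D / 16) = D / 8 := by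
      rw [div_eq_mul_inv, div_eq_mul_inv, mul_left_comm]
      congr 1
      rw [show (16 : ℝ≥0∞) = 2 * 8 by norm_num, ENNReal.mul_inv (by simp) (by simp), ← mul_assoc,
        ENNReal.mul_inv_cancel (by simp) (by simp), one_mul]
    rw [← h2, mul_left_comm] at h1
    exact (ENNReal.mul_le_mul_iff_right (by simp) (by simp)).1 h1
  have hcard : (Fintype.card (Fin m → Bool) : ℝ≥0∞) ≠ 0 := by
    exact_mod_cast Fintype.card_ne_zero
  refine (ENNReal.mul_le_mul_iff_right hcard (ENNReal.natCast_ne_top _)).1 ?_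
  calc (Fintype.card (Fin m → Bool) : ℝ≥0∞) * (m * (D / 16))
      = ∑ _j : Fin m, (Fintype.card (Fin m → Bool) : ℝ≥0∞) * (D / 16) := by
        rw [Finset.sum_const, nsmul_eq_mul, Finset.card_univ, Fintype.card_fin]; ring
    _ ≤ ∑ j, ∑ e, R e j := Finset.sum_le_sum fun j _ => hcol j
    _ = ∑ e, ∑ j, R e j := Finset.sum_comm
    _ ≤ ∑ _e : Fin m → Bool, S := Finset.sum_le_sum fun e _ => hloc e
    _ = _ := by rw [Finset.sum_const, nsmul_eq_mul, Finset.card_univ]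

/-! ### The model in logarithmic coordinates -/

/-- The density `u ↦ e^u p(e^u)` of `log Y`, where `Y` has density `p`. -/
noncomputable def logDensity (p : ℝ → ℝ) (u : ℝ) : ℝ := Real.exp u * p (Real.exp u)

/-- The density of `log (θ Y)` for independent `θ`, `Y` such that `log θ` has density `g` and `Y`
has density `p`; for a general function `g`, the convolution of `g` with `logDensity p`. -/
noncomputable def logMixture (p g : ℝ → ℝ) (y : ℝ) : ℝ := ∫ u, g (y - u) * logDensity p u

theorem setLIntegral_Ioi_eq_lintegral_exp (F : ℝ → ℝ≥0∞) :
    ∫⁻ x in Ioi (0 : ℝ), F x = ∫⁻ y, ENNReal.ofReal (Real.exp y) * F (Real.exp y) := by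
  have h := lintegral_image_eq_lintegral_abs_deriv_mul (s := univ) (f := Real.exp)
    (f' := Real.exp) MeasurableSet.univ (fun x _ => (Real.hasDerivAt_exp x).hasDerivWithinAt)
    Real.exp_injective.injOn F
  rw [image_univ, Real.range_exp, Measure.restrict_univ] at h
  simpa [abs_of_pos (Real.exp_pos _)] using h

section LogCoordinates

variable {p : ℝ → ℝ}

theorem IsDensityOnPos.measurable_logDensity (hp : IsDensityOnPos p) :
    Measurable (logDensity p) :=
  Real.measurable_exp.mul (hp.measurable.comp Real.measurable_exp)

theorem IsDensityOnPos.logDensity_nonneg (hp : IsDensityOnPos p) (u : ℝ) : 0 ≤ logDensity p u :=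
  mul_nonneg (Real.exp_pos u).le (hp.nonneg _ (Real.exp_pos u))

theorem IsDensityOnPos.lintegral_logDensity (hp : IsDensityOnPos p) :
    ∫⁻ u, ENNReal.ofReal (logDensity p u) = 1 := by
  rw [← hp.lintegral_eq_one, setLIntegral_Ioi_eq_lintegral_exp]
  refine lintegral_congr fun u => ?_
  rw [logDensity, ENNReal.ofReal_mul (Real.exp_pos u).le]

theorem IsDensityOnPos.integrable_logDensity (hp : IsDensityOnPos p) :
    Integrable (logDensity p) := by
  refine ⟨hp.measurable_logDensity.aestronglyMeasurable, ?_⟩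
  rw [hasFiniteIntegral_iff_ofReal (ae_of_all _ hp.logDensity_nonneg), hp.lintegral_logDensity]
  exact ENNReal.one_lt_top

theorem IsDensityOnPos.integral_logDensity (hp : IsDensityOnPos p) :
    ∫ u, logDensity p u = 1 := by
  rw [integral_eq_lintegral_of_nonneg_ae (ae_of_all _ hp.logDensity_nonneg)
    hp.measurable_logDensity.aestronglyMeasurable, hp.lintegral_logDensity, ENNReal.toReal_one]

theorem IsDensityOnPos.integrable_logMixture (hp : IsDensityOnPos p) {g : ℝ → ℝ}
    (hg : Measurable g) {B : ℝ} (hB : ∀ x, |g x| ≤ B) (y : ℝ) :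
    Integrable fun u => g (y - u) * logDensity p u :=
  hp.integrable_logDensity.bdd_mul (hg.comp (measurable_const.sub measurable_id)).aestronglyMeasurable
    (ae_of_all _ fun u => hB (y - u))

theorem IsDensityOnPos.measurable_logMixture (hp : IsDensityOnPos p) {g : ℝ → ℝ}
    (hg : Measurable g) : Measurable (logMixture p g) := by
  have : StronglyMeasurable (Function.uncurry fun y u : ℝ => g (y - u) * logDensity p u) :=
    ((hg.comp (measurable_fst.sub measurable_snd)).mul
      (hp.measurable_logDensity.comp measurable_snd)).stronglyMeasurable
  exact this.integral_prod_right.measurable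

theorem IsDensityOnPos.logMixture_nonneg (hp : IsDensityOnPos p) {g : ℝ → ℝ}
    (hg : ∀ x, 0 ≤ g x) (y : ℝ) : 0 ≤ logMixture p g y :=
  integral_nonneg fun u => mul_nonneg (hg _) (hp.logDensity_nonneg u)

theorem IsDensityOnPos.ofReal_logMixture (hp : IsDensityOnPos p) {g : ℝ → ℝ}
    (hg : Measurable g) (hg0 : ∀ x, 0 ≤ g x) {B : ℝ} (hB : ∀ x, |g x| ≤ B) (y : ℝ) :
    ENNReal.ofReal (logMixture p g y) = ∫⁻ u, ENNReal.ofReal (g (y - u) * logDensity p u) :=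
  ofReal_integral_eq_lintegral_ofReal (hp.integrable_logMixture hg hB y)
    (ae_of_all _ fun u => mul_nonneg (hg0 _) (hp.logDensity_nonneg u))

theorem IsDensityOnPos.mixtureDensity_expTransform (hp : IsDensityOnPos p) {g : ℝ → ℝ}
    (hg : Measurable g) (hg0 : ∀ x, 0 ≤ g x) {B : ℝ} (hB : ∀ x, |g x| ≤ B) {x : ℝ} (hx : 0 < x) :
    mixtureDensity p (expTransform g) x
      = ENNReal.ofReal (x⁻¹) * ENNReal.ofReal (logMixture p g (Real.log x)) := by
  rw [mixtureDensity, setLIntegral_Ioi_eq_lintegral_exp, hp.ofReal_logMixture hg hg0 hB,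
    ← lintegral_const_mul' _ _ ENNReal.ofReal_ne_top,
    ← lintegral_sub_left_eq_self _ (Real.log x)]
  refine lintegral_congr fun u => ?_
  rw [← ENNReal.ofReal_mul (Real.exp_pos _).le, ← ENNReal.ofReal_mul (inv_pos.2 hx).le]
  congr 1
  have h1 : Real.exp (Real.log x - u) = x / Real.exp u := by rw [Real.exp_sub, Real.exp_log hx]
  have h2 : x / (x / Real.exp u) = Real.exp u := by
    field_simp
  rw [expTransform, scaleFamily, Real.log_exp, h1, h2, logDensity]
  have := (Real.exp_pos u).ne'
  field_simp

theorem IsDensityOnPos.lintegral_mixtureMeasure (hp : IsDensityOnPos p) {g : ℝ → ℝ}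
    (hg : Measurable g) (hg0 : ∀ x, 0 ≤ g x) {B : ℝ} (hB : ∀ x, |g x| ≤ B) {F : ℝ → ℝ≥0∞}
    (hF : Measurable F) :
    ∫⁻ x, F x ∂(mixtureMeasure p (expTransform g))
      = ∫⁻ y, ENNReal.ofReal (logMixture p g y) * F (Real.exp y) := by
  have hm : Measurable fun x : ℝ =>
      ENNReal.ofReal (x⁻¹) * ENNReal.ofReal (logMixture p g (Real.log x)) :=
    measurable_inv.ennreal_ofReal.mul
      ((hp.measurable_logMixture hg).comp Real.measurable_log).ennreal_ofReal
  have hae : mixtureDensity p (expTransform g) =ᵐ[volume.restrict (Ioi (0 : ℝ))] fun x : ℝ =>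
      ENNReal.ofReal (x⁻¹) * ENNReal.ofReal (logMixture p g (Real.log x)) := by
    filter_upwards [ae_restrict_mem measurableSet_Ioi] with x hx
    exact hp.mixtureDensity_expTransform hg hg0 hB hx
  rw [mixtureMeasure, withDensity_congr_ae hae, lintegral_withDensity_eq_lintegral_mul _ hm hF,
    setLIntegral_Ioi_eq_lintegral_exp]
  refine lintegral_congr fun y => ?_
  rw [Pi.mul_apply, Real.log_exp, ← mul_assoc, ← mul_assoc,
    ← ENNReal.ofReal_mul (Real.exp_pos y).le, mul_inv_cancel₀ (Real.exp_pos y).ne',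
    ENNReal.ofReal_one, one_mul]

theorem IsDensityOnPos.lintegral_logMixture (hp : IsDensityOnPos p) {g : ℝ → ℝ}
    (hg : Measurable g) (hg0 : ∀ x, 0 ≤ g x) {B : ℝ} (hB : ∀ x, |g x| ≤ B)
    (hgi : Integrable g) (hg1 : ∫ x, g x = 1) :
    ∫⁻ y, ENNReal.ofReal (logMixture p g y) = 1 := by
  have hm : Measurable (Function.uncurry fun y u : ℝ =>
      ENNReal.ofReal (g (y - u) * logDensity p u)) :=
    ((hg.comp (measurable_fst.sub measurable_snd)).mul
      (hp.measurable_logDensity.comp measurable_snd)).ennreal_ofReal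
  simp_rw [hp.ofReal_logMixture hg hg0 hB]
  rw [lintegral_lintegral_swap hm.aemeasurable]
  have h1 : ∫⁻ x, ENNReal.ofReal (g x) = 1 := by
    rw [← ofReal_integral_eq_lintegral_ofReal hgi (ae_of_all _ hg0), hg1, ENNReal.ofReal_one]
  have : ∀ u, ∫⁻ y, ENNReal.ofReal (g (y - u) * logDensity p u)
      = ENNReal.ofReal (logDensity p u) := by
    intro u
    simp_rw [ENNReal.ofReal_mul (hg0 _)]
    rw [lintegral_mul_const' _ _ ENNReal.ofReal_ne_top,
      lintegral_sub_right_eq_self (fun y => ENNReal.ofReal (g y)) u, h1, one_mul]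
  simp_rw [this]
  exact hp.lintegral_logDensity

theorem IsDensityOnPos.isProbabilityMeasure_mixtureMeasure (hp : IsDensityOnPos p) {g : ℝ → ℝ}
    (hg : Measurable g) (hg0 : ∀ x, 0 ≤ g x) {B : ℝ} (hB : ∀ x, |g x| ≤ B)
    (hgi : Integrable g) (hg1 : ∫ x, g x = 1) :
    IsProbabilityMeasure (mixtureMeasure p (expTransform g)) := by
  constructor
  have := hp.lintegral_mixtureMeasure hg hg0 hB (F := fun _ => 1) measurable_const
  simpa [hp.lintegral_logMixture hg hg0 hB hgi hg1] using this

/-- The `χ²`-divergence of two mixture distributions, computed in logarithmic coordinates. -/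
theorem IsDensityOnPos.exists_likelihoodRatio (hp : IsDensityOnPos p) {g g' : ℝ → ℝ}
    (hg : Measurable g) (hg0 : ∀ x, 0 ≤ g x) {B : ℝ} (hB : ∀ x, |g x| ≤ B)
    (hgi : Integrable g) (hg1 : ∫ x, g x = 1)
    (hg' : Measurable g') (hg0' : ∀ x, 0 ≤ g' x) (hB' : ∀ x, |g' x| ≤ B)
    (hgi' : Integrable g') (hg1' : ∫ x, g' x = 1)
    (hpos : ∀ y, 0 < logMixture p g y) {δ : ℝ≥0∞}
    (hδ : ∫⁻ y, ENNReal.ofReal ((logMixture p g' y - logMixture p g y) ^ 2 / logMixture p g y)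
      ≤ δ) :
    ∃ ℓ : ℝ → ℝ≥0∞, Measurable ℓ ∧
      mixtureMeasure p (expTransform g') = (mixtureMeasure p (expTransform g)).withDensity ℓ ∧
      ∫⁻ x, ℓ x ^ 2 ∂(mixtureMeasure p (expTransform g)) ≤ 1 + δ := by
  set G := logMixture p g with hG
  set G' := logMixture p g' with hG'
  have hGm : Measurable G := hp.measurable_logMixture hg
  have hGm' : Measurable G' := hp.measurable_logMixture hg'
  have hG0' : ∀ y, 0 ≤ G' y := hp.logMixture_nonneg hg0'
  set ℓ : ℝ → ℝ≥0∞ := fun x => ENNReal.ofReal (G' (Real.log x) / G (Real.log x)) with hℓ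
  have hℓm : Measurable ℓ := ((hGm'.div hGm).comp Real.measurable_log).ennreal_ofReal
  refine ⟨ℓ, hℓm, ?_, ?_⟩
  · ext s hs
    rw [withDensity_apply _ hs, ← lintegral_indicator hs, ← lintegral_indicator_one hs,
      hp.lintegral_mixtureMeasure hg' hg0' hB' (measurable_one.indicator hs),
      hp.lintegral_mixtureMeasure hg hg0 hB (hℓm.indicator hs)]
    refine lintegral_congr fun y => ?_
    by_cases hy : Real.exp y ∈ s
    · rw [indicator_of_mem hy, indicator_of_mem hy, hℓ]
      simp only [Real.log_exp, Pi.one_apply, mul_one]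
      rw [← ENNReal.ofReal_mul (hpos y).le, mul_div_cancel₀ _ (hpos y).ne']
    · rw [indicator_of_notMem hy, indicator_of_notMem hy]
      simp
  · have hone : ∫⁻ y, ENNReal.ofReal (G y) = 1 := hp.lintegral_logMixture hg hg0 hB hgi hg1
    have hone' : ∫⁻ y, ENNReal.ofReal (G' y) = 1 :=
      hp.lintegral_logMixture hg' hg0' hB' hgi' hg1'
    have hsq : ∀ y, ENNReal.ofReal (G y) * ℓ (Real.exp y) ^ 2 = ENNReal.ofReal (G' y ^ 2 / G y) := by
      intro y
      simp only [hℓ, Real.log_exp]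
      rw [← ENNReal.ofReal_pow (div_nonneg (hG0' y) (hpos y).le), ← ENNReal.ofReal_mul (hpos y).le]
      congr 1
      have := (hpos y).ne'
      field_simp
    rw [(hp.lintegral_mixtureMeasure hg hg0 hB (hℓm.pow_const 2)).trans (lintegral_congr hsq)]
    -- `G'² / G + G = 2 G' + (G' - G)² / G` with `∫ G = ∫ G' = 1`
    have hid : (∫⁻ y, ENNReal.ofReal (G' y ^ 2 / G y)) + 1
        = (∫⁻ y, ENNReal.ofReal ((G' y - G y) ^ 2 / G y)) + (1 + 1) := by
      have hm2 : Measurable fun y => ENNReal.ofReal (G' y) + ENNReal.ofReal (G' y) :=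
        hGm'.ennreal_ofReal.add hGm'.ennreal_ofReal
      nth_rewrite 1 [← hone]
      nth_rewrite 1 [← hone']
      nth_rewrite 1 [← hone']
      rw [← lintegral_add_right _ hGm.ennreal_ofReal,
        ← lintegral_add_right _ hGm'.ennreal_ofReal,
        ← lintegral_add_right _ hm2]
      refine lintegral_congr fun y => ?_
      have h0 := hpos y
      rw [← ENNReal.ofReal_add (by positivity) h0.le, ← ENNReal.ofReal_add (hG0' y) (hG0' y),
        ← ENNReal.ofReal_add (by positivity) (add_nonneg (hG0' y) (hG0' y))]
      congr 1
      field_simp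
      ring
    have h2 : ∫⁻ y, ENNReal.ofReal (G' y ^ 2 / G y)
        = (∫⁻ y, ENNReal.ofReal ((G' y - G y) ^ 2 / G y)) + 1 := by
      rw [← add_assoc] at hid
      exact (ENNReal.add_left_inj ENNReal.one_ne_top).1 hid
    rw [h2, add_comm]
    gcongr

end LogCoordinates

/-! ### Heavy-tailed densities with bounded derivatives -/

theorem hasDerivAt_pow_mul_one_add_sq_rpow (a : ℕ) (s x : ℝ) :
    HasDerivAt (fun x : ℝ => x ^ a * (1 + x ^ 2) ^ (-s))
      (a * (x ^ (a - 1) * (1 + x ^ 2) ^ (-s))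
        - 2 * s * (x ^ (a + 1) * (1 + x ^ 2) ^ (-(s + 1)))) x := by
  have hpos : (0 : ℝ) < 1 + x ^ 2 := by positivity
  have h1 : HasDerivAt (fun x : ℝ => 1 + x ^ 2) (2 * x) x := by
    simpa using (hasDerivAt_pow 2 x).const_add 1
  have h2 := h1.rpow_const (p := -s) (Or.inl hpos.ne')
  refine ((hasDerivAt_pow a x).mul h2).congr_deriv ?_
  rw [show -(s + 1) = -s - 1 by ring, pow_succ]
  ring

theorem contDiff_pow_mul_one_add_sq_rpow (a : ℕ) (s : ℝ) {n : WithTop ℕ∞} :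
    ContDiff ℝ n fun x : ℝ => x ^ a * (1 + x ^ 2) ^ (-s) :=
  (contDiff_id.pow a).mul ((contDiff_const.add (contDiff_id.pow 2)).rpow_const_of_ne
    fun x => by positivity)

theorem exists_abs_iteratedDeriv_pow_mul_one_add_sq_rpow_le (k : ℕ) :
    ∀ (a : ℕ) (s : ℝ), (a : ℝ) ≤ 2 * s →
      ∃ B : ℝ, 0 ≤ B ∧
        ∀ x : ℝ, |iteratedDeriv k (fun x : ℝ => x ^ a * (1 + x ^ 2) ^ (-s)) x| ≤ B := by
  induction k with
  | zero =>
    intro a s has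
    refine ⟨1, zero_le_one, fun x => ?_⟩
    have hpos : (0 : ℝ) < 1 + x ^ 2 := by positivity
    rw [iteratedDeriv_zero, abs_mul, abs_pow, abs_of_pos (Real.rpow_pos_of_pos hpos _),
      Real.rpow_neg hpos.le, ← div_eq_mul_inv, div_le_one (Real.rpow_pos_of_pos hpos _)]
    have h1 : |x| ≤ (1 + x ^ 2) ^ (1 / 2 : ℝ) := by
      rw [← Real.sqrt_eq_rpow, ← Real.sqrt_sq_eq_abs]
      exact Real.sqrt_le_sqrt (by linarith)
    calc |x| ^ a ≤ ((1 + x ^ 2) ^ (1 / 2 : ℝ)) ^ a := by gcongr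
      _ = (1 + x ^ 2) ^ ((a : ℝ) / 2) := by
        rw [← Real.rpow_natCast, ← Real.rpow_mul hpos.le]; ring_nf
      _ ≤ (1 + x ^ 2) ^ s :=
        Real.rpow_le_rpow_of_exponent_le (by nlinarith [sq_nonneg x]) (by linarith)
  | succ k ih =>
    intro a s has
    have hd : deriv (fun x : ℝ => x ^ a * (1 + x ^ 2) ^ (-s))
        = fun x => (a : ℝ) * (x ^ (a - 1) * (1 + x ^ 2) ^ (-s))
          - 2 * s * (x ^ (a + 1) * (1 + x ^ 2) ^ (-(s + 1))) :=
      funext fun x => (hasDerivAt_pow_mul_one_add_sq_rpow a s x).deriv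
    obtain ⟨B₁, hB₁, h₁⟩ := ih (a - 1) s (le_trans (by exact_mod_cast Nat.sub_le a 1) has)
    obtain ⟨B₂, hB₂, h₂⟩ := ih (a + 1) (s + 1) (by push_cast; linarith)
    refine ⟨|(a : ℝ)| * B₁ + |2 * s| * B₂, by positivity, fun x => ?_⟩
    rw [iteratedDeriv_succ', hd, iteratedDeriv_fun_sub
      (contDiff_const.mul (contDiff_pow_mul_one_add_sq_rpow _ _)).contDiffAt
      (contDiff_const.mul (contDiff_pow_mul_one_add_sq_rpow _ _)).contDiffAt,
      iteratedDeriv_const_mul _ (contDiff_pow_mul_one_add_sq_rpow _ _).contDiffAt,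
      iteratedDeriv_const_mul _ (contDiff_pow_mul_one_add_sq_rpow _ _).contDiffAt]
    refine (abs_sub _ _).trans ?_
    rw [abs_mul, abs_mul (2 * s)]
    gcongr
    exacts [h₁ x, h₂ x]

theorem integrable_one_add_sq_rpow {s : ℝ} (hs : 1 / 2 < s) :
    Integrable fun x : ℝ => (1 + x ^ 2) ^ (-s) := by
  have h := integrable_rpow_neg_one_add_norm_sq (E := ℝ) (μ := volume) (r := 2 * s)
    (by simp; linarith)
  refine h.congr (ae_of_all _ fun x => ?_)
  simp only [Real.norm_eq_abs, sq_abs]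
  congr 1
  ring

theorem abs_sub_le_of_abs_deriv_le {f : ℝ → ℝ} (hf : Differentiable ℝ f) {B : ℝ}
    (h0 : ∀ x, |f x| ≤ B) (h1 : ∀ x, |deriv f x| ≤ B) {θ : ℝ} (hθ0 : 0 ≤ θ) (hθ1 : θ ≤ 1)
    (u v : ℝ) : |f u - f v| ≤ 2 * B * |u - v| ^ θ := by
  have hB : 0 ≤ B := (abs_nonneg _).trans (h0 0)
  rcases le_or_gt 1 |u - v| with h | h
  · calc |f u - f v| ≤ |f u| + |f v| := abs_sub _ _
      _ ≤ 2 * B * 1 := by linarith [h0 u, h0 v]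
      _ ≤ _ := by gcongr; exact Real.one_le_rpow h hθ0
  · rcases eq_or_ne u v with rfl | huv
    · simp only [sub_self, abs_zero]; positivity
    · have hlip : |f u - f v| ≤ B * |u - v| :=
        Convex.norm_image_sub_le_of_norm_deriv_le (s := univ) (fun x _ => hf x)
          (fun x _ => h1 x) convex_univ (mem_univ v) (mem_univ u)
      have hpos : 0 < |u - v| := abs_pos.2 (sub_ne_zero.2 huv)
      have : |u - v| ≤ |u - v| ^ θ := by
        simpa using Real.rpow_le_rpow_of_exponent_ge hpos h.le hθ1
      calc |f u - f v| ≤ B * |u - v| := hlip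
        _ ≤ 2 * B * |u - v| ^ θ := by nlinarith [mul_le_mul_of_nonneg_left this hB]

theorem iteratedDeriv_const_mul_comp_mul_sub {f : ℝ → ℝ} (hf : ContDiff ℝ (⊤ : ℕ∞) f)
    (A τ x₀ : ℝ) (k : ℕ) :
    iteratedDeriv k (fun x => A * f (τ * (x - x₀)))
      = fun x => A * (τ ^ k * iteratedDeriv k f (τ * (x - x₀))) := by
  have hfk : ContDiff ℝ k f := hf.of_le (by exact_mod_cast le_top)
  funext x
  have h1 : ContDiff ℝ k fun x => f (τ * (x - x₀)) :=
    hfk.comp (contDiff_const.mul (contDiff_id.sub contDiff_const))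
  rw [iteratedDeriv_const_mul _ h1.contDiffAt,
    iteratedDeriv_comp_sub_const k (fun z => f (τ * z)) x₀, iteratedDeriv_comp_const_mul hfk]

/-- Rescaling by `τ` costs a factor `τ ^ α` in the Hölder constant of order `α`. -/
theorem abs_iteratedDeriv_sub_le_of_scale {f : ℝ → ℝ} (hf : ContDiff ℝ (⊤ : ℕ∞) f) {α : ℝ}
    (hα : 0 < α) {B : ℝ} (h0 : ∀ x, |iteratedDeriv ⌊α⌋₊ f x| ≤ B)
    (h1 : ∀ x, |iteratedDeriv (⌊α⌋₊ + 1) f x| ≤ B) {A τ : ℝ} (hA : 0 ≤ A) (hτ : 0 < τ)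
    (x₀ t u : ℝ) :
    |iteratedDeriv ⌊α⌋₊ (fun x => A * f (τ * (x - x₀))) t
        - iteratedDeriv ⌊α⌋₊ (fun x => A * f (τ * (x - x₀))) u|
      ≤ A * τ ^ α * (2 * B) * |t - u| ^ (α - (⌊α⌋₊ : ℝ)) := by
  set r := ⌊α⌋₊ with hr
  have hθ0 : 0 ≤ α - (r : ℝ) := sub_nonneg.2 (Nat.floor_le hα.le)
  have hθ1 : α - (r : ℝ) ≤ 1 := by linarith [Nat.lt_floor_add_one α]
  have hd : Differentiable ℝ (iteratedDeriv r f) :=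
    hf.differentiable_iteratedDeriv r (by exact_mod_cast ENat.natCast_lt_top r)
  have key := abs_sub_le_of_abs_deriv_le hd h0 (by simpa only [iteratedDeriv_succ] using h1)
    hθ0 hθ1 (τ * (t - x₀)) (τ * (u - x₀))
  rw [iteratedDeriv_const_mul_comp_mul_sub hf]
  simp only
  rw [← mul_sub, ← mul_sub, abs_mul, abs_mul, abs_of_nonneg hA, abs_of_pos (pow_pos hτ r)]
  have hd2 : |τ * (t - x₀) - τ * (u - x₀)| = τ * |t - u| := by
    rw [← mul_sub, abs_mul, abs_of_pos hτ]; congr 2; ring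
  rw [hd2, Real.mul_rpow hτ.le (abs_nonneg _)] at key
  have hsplit : τ ^ α = τ ^ r * τ ^ (α - (r : ℝ)) := by
    rw [← Real.rpow_natCast, ← Real.rpow_add hτ]; congr 1; ring
  rw [hsplit]
  calc A * (τ ^ r * |iteratedDeriv r f (τ * (t - x₀)) - iteratedDeriv r f (τ * (u - x₀))|)
      ≤ A * (τ ^ r * (2 * B * (τ ^ (α - (r : ℝ)) * |t - u| ^ (α - (r : ℝ))))) := by gcongr
    _ = _ := by ring

/-- Dilating a fixed density `c (1 + x²)^(-s)` enough brings its Hölder constant below any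
prescribed level. -/
theorem exists_heavyTailed_mem_holderDensities {α C s : ℝ} (hα : 0 < α) (hC : 0 < C)
    (hs : 1 / 2 < s) :
    ∃ g : ℝ → ℝ, g ∈ holderDensities α C ∧ ContDiff ℝ (⊤ : ℕ∞) g ∧
      ∃ κ B : ℝ, 0 < κ ∧ ∀ x, κ * (1 + x ^ 2) ^ (-s) ≤ g x ∧ g x ≤ B := by
  set w : ℝ → ℝ := fun x => (1 + x ^ 2) ^ (-s) with hw
  have hweq : w = fun x => x ^ 0 * (1 + x ^ 2) ^ (-s) := by funext x; simp [hw]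
  have hwc : ContDiff ℝ (⊤ : ℕ∞) w := by
    rw [hweq]; exact contDiff_pow_mul_one_add_sq_rpow 0 s
  have hwpos : ∀ x, 0 < w x := fun x => Real.rpow_pos_of_pos (by positivity) _
  have hwle : ∀ x, w x ≤ 1 := fun x =>
    Real.rpow_le_one_of_one_le_of_nonpos (by nlinarith [sq_nonneg x]) (by linarith)
  have hwi : Integrable w := integrable_one_add_sq_rpow hs
  have hI : 0 < ∫ x, w x := by
    rw [integral_pos_iff_support_of_nonneg (fun x => (hwpos x).le) hwi]
    have : Function.support w = univ := by ext x; simp [(hwpos x).ne']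
    rw [this]; simp
  obtain ⟨B₀, hB₀, h₀⟩ :=
    exists_abs_iteratedDeriv_pow_mul_one_add_sq_rpow_le ⌊α⌋₊ 0 s (by push_cast; linarith)
  obtain ⟨B₁, hB₁, h₁⟩ :=
    exists_abs_iteratedDeriv_pow_mul_one_add_sq_rpow_le (⌊α⌋₊ + 1) 0 s (by push_cast; linarith)
  rw [← hweq] at h₀ h₁
  set B := B₀ + B₁
  set I := ∫ x, w x
  have hlim : Tendsto (fun l : ℝ => I⁻¹ * l * l ^ α * (2 * B)) (𝓝[>] 0) (𝓝 0) := by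
    have : ContinuousAt (fun l : ℝ => I⁻¹ * l * l ^ α * (2 * B)) 0 :=
      ((continuousAt_const.mul continuousAt_id).mul
        (Real.continuousAt_rpow_const 0 α (Or.inr hα.le))).mul continuousAt_const
    have h := this.tendsto
    simp only [mul_zero, zero_mul] at h
    exact h.mono_left nhdsWithin_le_nhds
  obtain ⟨l, hlC, hl1, hl⟩ : ∃ l : ℝ, I⁻¹ * l * l ^ α * (2 * B) ≤ C ∧ l ≤ 1 ∧ 0 < l := by
    have e1 : ∀ᶠ l : ℝ in 𝓝[>] 0, I⁻¹ * l * l ^ α * (2 * B) ≤ C :=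
      hlim.eventually (eventually_le_nhds hC)
    have e2 : ∀ᶠ l : ℝ in 𝓝[>] 0, l ≤ 1 :=
      nhdsWithin_le_nhds (eventually_le_nhds one_pos)
    exact (e1.and (e2.and self_mem_nhdsWithin)).exists
  have hA : 0 < I⁻¹ * l := by positivity
  have hgc : ContDiff ℝ (⊤ : ℕ∞) fun x => I⁻¹ * l * w (l * (x - 0)) :=
    contDiff_const.mul (hwc.comp (contDiff_const.mul (contDiff_id.sub contDiff_const)))
  refine ⟨fun x => I⁻¹ * l * w (l * (x - 0)), ⟨fun t => ?_, ?_, ?_, fun k _ => ?_, fun t u => ?_⟩,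
    hgc, I⁻¹ * l, I⁻¹ * l, hA, fun x => ⟨?_, ?_⟩⟩
  · exact mul_nonneg hA.le (hwpos _).le
  · simp only [sub_zero]
    exact (hwi.comp_mul_left' hl.ne').const_mul _
  · simp only [sub_zero]
    rw [integral_const_mul, Measure.integral_comp_mul_left w l, abs_of_pos (inv_pos.2 hl),
      smul_eq_mul]
    change I⁻¹ * l * (l⁻¹ * I) = 1
    field_simp
  · exact hgc.differentiable_iteratedDeriv k (by exact_mod_cast ENat.natCast_lt_top k)
  · refine (abs_iteratedDeriv_sub_le_of_scale hwc hα (B := B) (fun x => ?_) (fun x => ?_) hA.le hl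
      0 t u).trans ?_
    · exact (h₀ x).trans (le_add_of_nonneg_right hB₁)
    · exact (h₁ x).trans (le_add_of_nonneg_left hB₀)
    · gcongr
  · simp only [sub_zero]
    refine mul_le_mul_of_nonneg_left ?_ hA.le
    simp only [hw]
    refine Real.rpow_le_rpow_of_nonpos (by positivity) ?_ (by linarith)
    nlinarith [mul_nonneg (sub_nonneg.2 hl1) hl.le, sq_nonneg x, sq_nonneg l,
      mul_nonneg (sq_nonneg x) (show 0 ≤ 1 - l ^ 2 by nlinarith)]
  · exact mul_le_of_le_one_right hA.le (hwle _)

/-! ### Superpositions of shifted Schwartz functions -/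

theorem exists_sum_inv_one_add_sq_le :
    ∃ M : ℝ, 0 < M ∧ ∀ (m : ℕ) (y : ℝ), ∑ j : Fin m, (1 + (y - (j : ℝ)) ^ 2)⁻¹ ≤ M := by
  have hsum : Summable fun i : ℤ => (1 + (i : ℝ) ^ 2)⁻¹ := by
    refine Summable.of_norm_bounded_eventually
      (Real.summable_one_div_int_pow.2 (one_lt_two : 1 < 2)) ?_
    filter_upwards [(finite_singleton (0 : ℤ)).compl_mem_cofinite] with i hi
    have hi' : (i : ℝ) ≠ 0 := by exact_mod_cast hi
    rw [Real.norm_of_nonneg (by positivity), one_div]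
    exact inv_anti₀ (by positivity) (by linarith)
  refine ⟨3 * ∑' i : ℤ, (1 + (i : ℝ) ^ 2)⁻¹,
    mul_pos three_pos (hsum.tsum_pos (fun i => by positivity) 0 (by positivity)), fun m y => ?_⟩
  have hterm : ∀ j : Fin m, (1 + (y - (j : ℝ)) ^ 2)⁻¹
      ≤ 3 * (1 + ((⌊y⌋ - (j : ℤ) : ℤ) : ℝ) ^ 2)⁻¹ := by
    intro j
    push_cast
    have h1 := Int.floor_le y
    have h2 := Int.lt_floor_add_one y
    rw [← div_eq_mul_inv, inv_eq_one_div, div_le_div_iff₀ (by positivity) (by positivity)]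
    set d := y - (⌊y⌋ : ℝ) with hd
    have : (⌊y⌋ : ℝ) - j = (y - j) - d := by rw [hd]; ring
    rw [this]
    have hd0 : 0 ≤ d := by rw [hd]; linarith
    have hd1 : d ≤ 1 := by rw [hd]; linarith
    nlinarith [sq_nonneg (y - j + d), mul_nonneg hd0 (sub_nonneg.2 hd1)]
  have hinj : Function.Injective fun j : Fin m => ⌊y⌋ - (j : ℤ) := by
    intro i j hij
    simp only [sub_right_inj, Nat.cast_inj] at hij
    exact Fin.ext hij
  calc ∑ j : Fin m, (1 + (y - (j : ℝ)) ^ 2)⁻¹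
      ≤ ∑ j : Fin m, 3 * (1 + ((⌊y⌋ - (j : ℤ) : ℤ) : ℝ) ^ 2)⁻¹ :=
        Finset.sum_le_sum fun j _ => hterm j
    _ = 3 * ∑ i ∈ Finset.univ.map ⟨fun j : Fin m => ⌊y⌋ - (j : ℤ), hinj⟩, (1 + (i : ℝ) ^ 2)⁻¹ := by
        rw [← Finset.mul_sum, Finset.sum_map]; rfl
    _ ≤ _ := by
        gcongr
        exact hsum.sum_le_tsum _ fun i _ => by positivity

theorem SchwartzMap.exists_abs_iteratedDeriv_le (ψ : SchwartzMap ℝ ℝ) (k : ℕ) :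
    ∃ K : ℝ, 0 < K ∧ ∀ x, |iteratedDeriv k ψ x| ≤ K * ((1 + x ^ 2)⁻¹ * (1 + x ^ 2)⁻¹) := by
  obtain ⟨K₀, hK₀, h₀⟩ := ψ.decay 0 k
  obtain ⟨K₄, hK₄, h₄⟩ := ψ.decay 4 k
  refine ⟨2 * (K₀ + K₄), by positivity, fun x => ?_⟩
  have h0 := h₀ x
  have h4 := h₄ x
  simp only [norm_iteratedFDeriv_eq_norm_iteratedDeriv, Real.norm_eq_abs, pow_zero, one_mul]
    at h0 h4
  rw [show |x| ^ 4 = x ^ 4 by rw [← abs_pow]; exact abs_of_nonneg (by positivity)] at h4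
  rw [← mul_inv, ← div_eq_mul_inv, le_div_iff₀ (by positivity)]
  nlinarith [mul_nonneg (abs_nonneg (iteratedDeriv k ψ x)) (sq_nonneg (x ^ 2 - 1))]

/-- The superposition `∑ e_j ψ(y - j)` of integer shifts of `ψ`, over the `j < m` whose bit in `e`
is set. -/
noncomputable def bumpSum (ψ : ℝ → ℝ) {m : ℕ} (e : Fin m → Bool) (y : ℝ) : ℝ :=
  ∑ j, (if e j then 1 else 0) * ψ (y - (j : ℝ))

theorem contDiff_bumpSum (ψ : SchwartzMap ℝ ℝ) {m : ℕ} (e : Fin m → Bool) :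
    ContDiff ℝ (⊤ : ℕ∞) (bumpSum ψ e) :=
  ContDiff.sum fun _ _ => contDiff_const.mul (ψ.smooth'.comp (contDiff_id.sub contDiff_const))

theorem iteratedDeriv_bumpSum (ψ : SchwartzMap ℝ ℝ) {m : ℕ} (e : Fin m → Bool) (k : ℕ) (y : ℝ) :
    iteratedDeriv k (bumpSum ψ e) y = bumpSum (iteratedDeriv k ψ) e y := by
  have hψ : ContDiff ℝ k ψ := ψ.smooth'.of_le (by exact_mod_cast le_top)
  have h : ∀ j : Fin m, ContDiff ℝ k fun y : ℝ => ψ (y - (j : ℝ)) := fun j =>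
    hψ.comp (contDiff_id.sub contDiff_const)
  change iteratedDeriv k (fun y => ∑ j, (if e j then (1 : ℝ) else 0) * ψ (y - (j : ℝ))) y = _
  rw [iteratedDeriv_fun_sum fun j _ => (contDiff_const.mul (h j)).contDiffAt]
  refine Finset.sum_congr rfl fun j _ => ?_
  rw [iteratedDeriv_const_mul _ (h j).contDiffAt, iteratedDeriv_comp_sub_const k ψ]

theorem abs_bumpSum_le {ψ : ℝ → ℝ} {m : ℕ} (e : Fin m → Bool) (y : ℝ) :
    |bumpSum ψ e y| ≤ ∑ j : Fin m, |ψ (y - (j : ℝ))| := by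
  refine (Finset.abs_sum_le_sum_abs _ _).trans (Finset.sum_le_sum fun j _ => ?_)
  rw [abs_mul]
  split_ifs <;> simp

theorem SchwartzMap.exists_abs_iteratedDeriv_bumpSum_le (ψ : SchwartzMap ℝ ℝ) (k : ℕ) :
    ∃ B : ℝ, 0 < B ∧ ∀ (m : ℕ) (e : Fin m → Bool) (y : ℝ),
      |iteratedDeriv k (bumpSum ψ e) y| ≤ B := by
  obtain ⟨M, hM, hsum⟩ := exists_sum_inv_one_add_sq_le
  obtain ⟨K, hK, hψ⟩ := ψ.exists_abs_iteratedDeriv_le k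
  refine ⟨K * M, by positivity, fun m e y => ?_⟩
  rw [iteratedDeriv_bumpSum]
  refine (abs_bumpSum_le e y).trans ?_
  calc ∑ j : Fin m, |iteratedDeriv k ψ (y - (j : ℝ))|
      ≤ ∑ j : Fin m, K * (1 + (y - (j : ℝ)) ^ 2)⁻¹ := by
        refine Finset.sum_le_sum fun j _ => (hψ _).trans ?_
        gcongr
        exact mul_le_of_le_one_right (by positivity)
          (inv_le_one_of_one_le₀ (by nlinarith [sq_nonneg (y - (j : ℝ))]))
    _ ≤ K * M := by
        rw [← Finset.mul_sum]
        gcongr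
        exact hsum m y

/-- The centres `x₀ + j / τ`, `j < τ L`, of the rescaled bumps stay in a bounded set, so their
superposition decays like `(1 + x²)⁻¹` uniformly in `τ`. -/
theorem SchwartzMap.exists_abs_bumpSum_scale_le (ψ : SchwartzMap ℝ ℝ) (x₀ : ℝ) {L : ℝ}
    (hL : 0 < L) :
    ∃ K : ℝ, 0 < K ∧ ∀ (m : ℕ), 0 < m → ∀ (e : Fin m → Bool) (x : ℝ),
      |bumpSum ψ e ((m / L) * (x - x₀))| ≤ K * (1 + x ^ 2)⁻¹ := by
  obtain ⟨M, hM, hsum⟩ := exists_sum_inv_one_add_sq_le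
  obtain ⟨K, hK, hψ⟩ := ψ.exists_abs_iteratedDeriv_le 0
  simp only [iteratedDeriv_zero] at hψ
  set R := |x₀| + L with hR
  have hR0 : 0 < R := by positivity
  refine ⟨K * (1 + 2 * R ^ 2 + 2 * L ^ 2) * M, by positivity, fun m hm e x => ?_⟩
  have hm1 : (1 : ℝ) ≤ m := by exact_mod_cast hm
  set τ := (m : ℝ) / L with hτ
  have hτ0 : 0 < τ := by positivity
  have hτL : 1 ≤ τ * L := by rw [hτ, div_mul_cancel₀ _ hL.ne']; exact hm1
  set y := τ * (x - x₀) with hy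
  have hfar : ∀ j : Fin m, (1 + (y - (j : ℝ)) ^ 2)⁻¹
      ≤ (1 + 2 * R ^ 2 + 2 * L ^ 2) * (1 + x ^ 2)⁻¹ := by
    intro j
    have hj : (j : ℝ) ≤ m := by exact_mod_cast j.2.le
    set z := x₀ + j / τ with hz
    have hzR : z ^ 2 ≤ R ^ 2 := by
      rw [sq_le_sq, abs_of_pos hR0]
      refine (abs_add_le _ _).trans ?_
      rw [hR]
      gcongr
      rw [abs_of_nonneg (by positivity), div_le_iff₀ hτ0, hτ, mul_div_cancel₀ _ hL.ne']
      exact hj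
    have hyz : y - j = τ * (x - z) := by
      rw [hy, hz]; field_simp; ring
    rw [inv_eq_one_div, ← div_eq_mul_inv, div_le_div_iff₀ (by positivity) (by positivity), hyz,
      one_mul]
    have h1 : (x - z) ^ 2 ≤ L ^ 2 * (τ * (x - z)) ^ 2 := by
      have : L ^ 2 * (τ * (x - z)) ^ 2 = (τ * L) ^ 2 * (x - z) ^ 2 := by ring
      rw [this]
      exact le_mul_of_one_le_left (sq_nonneg _) (one_le_pow₀ hτL)
    have h2 : x ^ 2 ≤ 2 * (x - z) ^ 2 + 2 * z ^ 2 := by nlinarith [sq_nonneg (x - 2 * z)]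
    have h3 : 0 ≤ (2 * R ^ 2 + 1) * (τ * (x - z)) ^ 2 := by positivity
    nlinarith [sq_nonneg L]
  refine (abs_bumpSum_le e y).trans ?_
  calc ∑ j : Fin m, |ψ (y - (j : ℝ))|
      ≤ ∑ j : Fin m, K * (((1 + 2 * R ^ 2 + 2 * L ^ 2) * (1 + x ^ 2)⁻¹)
          * (1 + (y - (j : ℝ)) ^ 2)⁻¹) := by
        refine Finset.sum_le_sum fun j _ => (hψ _).trans ?_
        gcongr
        exact hfar j
    _ = K * ((1 + 2 * R ^ 2 + 2 * L ^ 2) * (1 + x ^ 2)⁻¹)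
          * ∑ j : Fin m, (1 + (y - (j : ℝ)) ^ 2)⁻¹ := by
        rw [Finset.mul_sum]; exact Finset.sum_congr rfl fun j _ => by ring
    _ ≤ K * ((1 + 2 * R ^ 2 + 2 * L ^ 2) * (1 + x ^ 2)⁻¹) * M := by
        gcongr; exact hsum m y
    _ = _ := by ring

theorem integrable_bumpSum (ψ : SchwartzMap ℝ ℝ) {m : ℕ} (e : Fin m → Bool) :
    Integrable (bumpSum ψ e) :=
  integrable_finsetSum _ fun j _ => (ψ.integrable.comp_sub_right (j : ℝ)).const_mul _

theorem integral_bumpSum (ψ : SchwartzMap ℝ ℝ) (hψ : ∫ x, ψ x = 0) {m : ℕ} (e : Fin m → Bool) :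
    ∫ y, bumpSum ψ e y = 0 := by
  have h : ∀ j : Fin m, Integrable fun y => (if e j then (1 : ℝ) else 0) * ψ (y - (j : ℝ)) :=
    fun j => (ψ.integrable.comp_sub_right (j : ℝ)).const_mul _
  refine (integral_finsetSum _ fun j _ => h j).trans ?_
  refine Finset.sum_eq_zero fun j _ => ?_
  rw [integral_const_mul, integral_sub_right_eq_self (fun y => ψ y) (j : ℝ), hψ, mul_zero]

theorem bumpSum_flipBit_sub (ψ : ℝ → ℝ) {m : ℕ} (e : Fin m → Bool) (j : Fin m) (y : ℝ) :
    bumpSum ψ (flipBit j e) y - bumpSum ψ e y = (if e j then -1 else 1) * ψ (y - (j : ℝ)) := by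
  unfold bumpSum
  rw [← Finset.sum_sub_distrib, Finset.sum_eq_single j]
  · rw [flipBit_apply_self]
    cases e j <;> simp
  · intro i _ hij
    rw [flipBit_apply_of_ne hij, sub_self]
  · simp

/-! ### The cube of densities and the resulting lower bound -/

/-- A heavy-tailed density `g` perturbed by `c τ^(-α)` times a superposition of bumps of width
`1 / τ`; the scaling keeps the Hölder constant of order `α` bounded. -/
noncomputable def cubeDensity (g ψ : ℝ → ℝ) (c α τ x₀ : ℝ) {m : ℕ} (e : Fin m → Bool) (x : ℝ) : ℝ :=
  g x + c * τ ^ (-α) * bumpSum ψ e (τ * (x - x₀))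

theorem exists_perturbation_small (ψ : SchwartzMap ℝ ℝ) (x₀ : ℝ) {L α C κ : ℝ} (hL : 0 < L)
    (hα : 0 < α) (hC : 0 < C) (hκ : 0 < κ) :
    ∃ c : ℝ, 0 < c ∧ ∀ m : ℕ, 0 < m → ∀ e : Fin m → Bool,
      (∀ x, |c * (m / L : ℝ) ^ (-α) * bumpSum ψ e ((m / L) * (x - x₀))| ≤ κ * (1 + x ^ 2)⁻¹) ∧
      ∀ t u, |iteratedDeriv ⌊α⌋₊
          (fun x => c * (m / L : ℝ) ^ (-α) * bumpSum ψ e ((m / L) * (x - x₀))) t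
        - iteratedDeriv ⌊α⌋₊
          (fun x => c * (m / L : ℝ) ^ (-α) * bumpSum ψ e ((m / L) * (x - x₀))) u|
        ≤ C * |t - u| ^ (α - (⌊α⌋₊ : ℝ)) := by
  obtain ⟨K, hK, hdecay⟩ := ψ.exists_abs_bumpSum_scale_le x₀ hL
  obtain ⟨B₀, hB₀, h₀⟩ := ψ.exists_abs_iteratedDeriv_bumpSum_le ⌊α⌋₊
  obtain ⟨B₁, hB₁, h₁⟩ := ψ.exists_abs_iteratedDeriv_bumpSum_le (⌊α⌋₊ + 1)
  have hLα : 0 < L ^ α := Real.rpow_pos_of_pos hL α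
  set c := min (κ / (L ^ α * K)) (C / (2 * (B₀ + B₁))) with hc
  have hc0 : 0 < c := lt_min (by positivity) (by positivity)
  have hc1 : c * (L ^ α * K) ≤ κ := by
    rw [← le_div_iff₀ (by positivity)]; exact min_le_left _ _
  have hc2 : c * (2 * (B₀ + B₁)) ≤ C := by
    rw [← le_div_iff₀ (by positivity)]; exact min_le_right _ _
  refine ⟨c, hc0, fun m hm e => ?_⟩
  have hm1 : (1 : ℝ) ≤ m := by exact_mod_cast hm
  have hτ : 0 < (m / L : ℝ) := by positivity
  have hτα : (m / L : ℝ) ^ (-α) ≤ L ^ α := by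
    rw [← inv_inv (m / L : ℝ), Real.inv_rpow (by positivity), Real.rpow_neg (by positivity),
      inv_inv, inv_div]
    gcongr
    exact div_le_self hL.le hm1
  have hτα0 : 0 < (m / L : ℝ) ^ (-α) := Real.rpow_pos_of_pos hτ _
  refine ⟨fun x => ?_, fun t u => ?_⟩
  · rw [abs_mul, abs_of_pos (mul_pos hc0 hτα0)]
    calc c * (m / L : ℝ) ^ (-α) * |bumpSum ψ e ((m / L) * (x - x₀))|
        ≤ c * L ^ α * (K * (1 + x ^ 2)⁻¹) := by gcongr; exact hdecay m hm e x
      _ = c * (L ^ α * K) * (1 + x ^ 2)⁻¹ := by ring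
      _ ≤ _ := by gcongr
  · refine (abs_iteratedDeriv_sub_le_of_scale (contDiff_bumpSum ψ e) hα (B := B₀ + B₁)
      (fun x => (h₀ m e x).trans (by linarith)) (fun x => (h₁ m e x).trans (by linarith))
      (mul_pos hc0 hτα0).le hτ x₀ t u).trans ?_
    have h1 : (m / L : ℝ) ^ (-α) * (m / L : ℝ) ^ α = 1 := by
      rw [← Real.rpow_add hτ, neg_add_cancel, Real.rpow_zero]
    calc c * (m / L : ℝ) ^ (-α) * (m / L : ℝ) ^ α * (2 * (B₀ + B₁)) * |t - u| ^ (α - (⌊α⌋₊ : ℝ))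
        = c * (2 * (B₀ + B₁)) * |t - u| ^ (α - (⌊α⌋₊ : ℝ)) := by
          rw [mul_assoc c, h1, mul_one]
      _ ≤ _ := by gcongr

/-- Convolution with a probability density does not make the tail `(1 + y²)^(-s)` lighter: half of
the mass of that density sits in a bounded interval. -/
theorem IsDensityOnPos.exists_le_logMixture {p : ℝ → ℝ} (hp : IsDensityOnPos p) {g : ℝ → ℝ}
    (hg : Measurable g) {κ B s : ℝ} (hκ : 0 < κ) (hs : 0 ≤ s)
    (hlow : ∀ x, κ * (1 + x ^ 2) ^ (-s) ≤ g x) (hB : ∀ x, g x ≤ B) :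
    ∃ κ' : ℝ, 0 < κ' ∧ ∀ y, κ' * (1 + y ^ 2) ^ (-s) ≤ logMixture p g y := by
  have hw : ∀ x : ℝ, 0 < (1 + x ^ 2) ^ (-s) := fun x => Real.rpow_pos_of_pos (by positivity) _
  have hg0 : ∀ x, 0 ≤ g x := fun x => (mul_pos hκ (hw x)).le.trans (hlow x)
  obtain ⟨R, hR⟩ : ∃ R : ℕ, (1 / 2 : ℝ) < ∫ u in Icc (-(R : ℝ)) R, logDensity p u := by
    have hmono : Monotone fun R : ℕ => Icc (-(R : ℝ)) R := by
      intro i j hij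
      have : (i : ℝ) ≤ j := by exact_mod_cast hij
      exact Icc_subset_Icc (by linarith) this
    have hun : ⋃ R : ℕ, Icc (-(R : ℝ)) R = univ := by
      refine eq_univ_of_forall fun x => ?_
      obtain ⟨n, hn⟩ := exists_nat_ge |x|
      exact mem_iUnion.2 ⟨n, abs_le.1 hn⟩
    have h := tendsto_setIntegral_of_monotone (μ := volume) (f := logDensity p)
      (fun R : ℕ => measurableSet_Icc) hmono hp.integrable_logDensity.integrableOn
    rw [hun, setIntegral_univ, hp.integral_logDensity] at h
    exact (h.eventually (lt_mem_nhds (by norm_num : (1 / 2 : ℝ) < 1))).exists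
  set A : ℝ := 2 * (1 + (R : ℝ) ^ 2) with hA
  have hA0 : 0 < A := by positivity
  have hAs : 0 < A ^ (-s) := Real.rpow_pos_of_pos hA0 _
  refine ⟨κ * A ^ (-s) * (1 / 2), by positivity, fun y => ?_⟩
  have hint := hp.integrable_logMixture hg (B := B)
    (fun x => by rw [abs_of_nonneg (hg0 x)]; exact hB x) y
  calc κ * A ^ (-s) * (1 / 2) * (1 + y ^ 2) ^ (-s)
      = κ * A ^ (-s) * (1 + y ^ 2) ^ (-s) * (1 / 2) := by ring
    _ ≤ κ * A ^ (-s) * (1 + y ^ 2) ^ (-s) * ∫ u in Icc (-(R : ℝ)) R, logDensity p u :=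
        mul_le_mul_of_nonneg_left hR.le (mul_pos (mul_pos hκ hAs) (hw y)).le
    _ = ∫ u in Icc (-(R : ℝ)) R, κ * A ^ (-s) * (1 + y ^ 2) ^ (-s) * logDensity p u :=
        (integral_const_mul _ _).symm
    _ ≤ ∫ u in Icc (-(R : ℝ)) R, g (y - u) * logDensity p u := by
        refine setIntegral_mono_on (hp.integrable_logDensity.integrableOn.const_mul _)
          hint.integrableOn measurableSet_Icc fun u hu => ?_
        refine mul_le_mul_of_nonneg_right (le_trans ?_ (hlow _)) (hp.logDensity_nonneg u)
        rw [mul_assoc]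
        refine mul_le_mul_of_nonneg_left ?_ hκ.le
        rw [← Real.mul_rpow hA0.le (by positivity)]
        refine Real.rpow_le_rpow_of_nonpos (by positivity) ?_ (by linarith)
        have hu2 : u ^ 2 ≤ (R : ℝ) ^ 2 := sq_le_sq' hu.1 hu.2
        rw [hA]
        nlinarith [sq_nonneg (y + u), mul_nonneg (sq_nonneg (R : ℝ)) (sq_nonneg y)]
    _ ≤ logMixture p g y :=
        setIntegral_le_integral hint
          (ae_of_all _ fun u => mul_nonneg (hg0 _) (hp.logDensity_nonneg u))

/-- The weighted `L²` size of a bump of width `1 / τ` after convolution with the density of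
`log Y`. Up to constants it is the `χ²`-divergence between neighbouring vertices of the cube. -/
noncomputable def blurredSize (p ψ : ℝ → ℝ) (s τ : ℝ) : ℝ≥0∞ :=
  ∫⁻ z, ENNReal.ofReal (logMixture p (fun x => ψ (τ * x)) z ^ 2 * (1 + z ^ 2) ^ s)

theorem holderDensities_add {α C₁ C₂ : ℝ} {g P : ℝ → ℝ} (hg : g ∈ holderDensities α C₁)
    (hgc : ContDiff ℝ (⊤ : ℕ∞) g) (hPc : ContDiff ℝ (⊤ : ℕ∞) P) (hP : ∀ x, |P x| ≤ g x)
    (hPi : Integrable P) (hP0 : ∫ x, P x = 0)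
    (hPH : ∀ t u, |iteratedDeriv ⌊α⌋₊ P t - iteratedDeriv ⌊α⌋₊ P u|
      ≤ C₂ * |t - u| ^ (α - (⌊α⌋₊ : ℝ))) :
    (fun x => g x + P x) ∈ holderDensities α (C₁ + C₂) := by
  obtain ⟨_, hgi, hg1, _, hgH⟩ := hg
  refine ⟨fun t => ?_, hgi.add hPi, ?_, fun k _ => ?_, fun t u => ?_⟩
  · linarith [(abs_le.1 (hP t)).1]
  · rw [integral_add hgi hPi, hg1, hP0, add_zero]
  · exact (hgc.add hPc).differentiable_iteratedDeriv k (by exact_mod_cast ENat.natCast_lt_top k)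
  · have hadd : ∀ x, iteratedDeriv ⌊α⌋₊ (fun x => g x + P x) x
        = iteratedDeriv ⌊α⌋₊ g x + iteratedDeriv ⌊α⌋₊ P x := fun x =>
      iteratedDeriv_fun_add (hgc.of_le (by exact_mod_cast le_top)).contDiffAt
        (hPc.of_le (by exact_mod_cast le_top)).contDiffAt
    rw [hadd, hadd, add_sub_add_comm, add_mul]
    exact (abs_add_le _ _).trans (add_le_add (hgH t u) (hPH t u))

theorem logMixture_cubeDensity_flipBit_sub {p : ℝ → ℝ} (hp : IsDensityOnPos p) {g ψ : ℝ → ℝ}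
    {c α τ x₀ : ℝ} (hτ : τ ≠ 0) {m : ℕ} (e : Fin m → Bool) (j : Fin m) {B : ℝ}
    (hm : ∀ e : Fin m → Bool, Measurable (cubeDensity g ψ c α τ x₀ e))
    (hB : ∀ (e : Fin m → Bool) x, |cubeDensity g ψ c α τ x₀ e x| ≤ B) (y : ℝ) :
    logMixture p (cubeDensity g ψ c α τ x₀ (flipBit j e)) y
        - logMixture p (cubeDensity g ψ c α τ x₀ e) y
      = (if e j then -1 else 1) * (c * τ ^ (-α))
        * logMixture p (fun x => ψ (τ * x)) (y - (x₀ + j / τ)) := by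
  unfold logMixture
  rw [← integral_sub (hp.integrable_logMixture (hm _) (hB _) y)
    (hp.integrable_logMixture (hm _) (hB _) y), ← integral_const_mul]
  refine integral_congr_ae (ae_of_all _ fun u => ?_)
  have harg : τ * (y - (x₀ + j / τ) - u) = τ * (y - u - x₀) - j := by field_simp; ring
  simp only [cubeDensity, harg]
  linear_combination (c * τ ^ (-α)) * logDensity p u
    * bumpSum_flipBit_sub ψ e j (τ * (y - u - x₀))

theorem lintegral_shift_sq_mul_le {W : ℝ → ℝ} {s R z₀ : ℝ} (hs : 0 ≤ s)
    (hz : |z₀| ≤ R) :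
    ∫⁻ y, ENNReal.ofReal (W (y - z₀) ^ 2 * (1 + y ^ 2) ^ s)
      ≤ ENNReal.ofReal ((2 + 2 * R ^ 2) ^ s)
        * ∫⁻ z, ENNReal.ofReal (W z ^ 2 * (1 + z ^ 2) ^ s) := by
  rw [← lintegral_add_right_eq_self _ z₀, ← lintegral_const_mul' _ _ ENNReal.ofReal_ne_top]
  refine lintegral_mono fun z => ?_
  rw [← ENNReal.ofReal_mul (by positivity), add_sub_cancel_right, mul_left_comm]
  refine ENNReal.ofReal_le_ofReal (mul_le_mul_of_nonneg_left ?_ (sq_nonneg _))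
  rw [← Real.mul_rpow (by positivity) (by positivity)]
  refine Real.rpow_le_rpow (by positivity) ?_ hs
  have h1 : z₀ ^ 2 ≤ R ^ 2 := sq_le_sq.2 (hz.trans (le_abs_self R))
  nlinarith [sq_nonneg (z - z₀), mul_nonneg (sq_nonneg R) (sq_nonneg z)]

/-- A lower bound for the separation of two functions on a set where they differ by at least
`d`. -/
theorem ofReal_le_eLpNorm_sq {h : ℝ → ℝ} {J : Set ℝ} (hJ : MeasurableSet J) {d v : ℝ} (hd : 0 ≤ d)
    (hh : ∀ t ∈ J, d ≤ |h t|) (hv : ENNReal.ofReal v ≤ volume J) :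
    ENNReal.ofReal (d ^ 2 * v) ≤ eLpNorm h 2 (volume.restrict J) ^ 2 := by
  rw [eLpNorm_two_sq_eq_lintegral, ENNReal.ofReal_mul (sq_nonneg d)]
  calc ENNReal.ofReal (d ^ 2) * ENNReal.ofReal v ≤ ENNReal.ofReal (d ^ 2) * volume J := by gcongr
    _ = ∫⁻ _t in J, ENNReal.ofReal (d ^ 2) := (setLIntegral_const _ _).symm
    _ ≤ _ := by
      refine setLIntegral_mono' hJ fun t ht => ?_
      rw [ENNReal.ofReal_pow hd, Real.enorm_eq_ofReal_abs]
      gcongr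
      exact hh t ht

/-- The lower bound `c τ^(-2α)` for the minimax risk, `τ = m / L`, as long as the neighbouring
vertices of a cube with `m` bumps on `[log a, log b]` cannot be distinguished from `n`
observations. -/
theorem exists_le_minimaxRisk_of_blurredSize_le {a b : ℝ} (ha : 0 < a) (hab : a < b) {p : ℝ → ℝ}
    (hp : IsDensityOnPos p) {α C : ℝ} (hα : 0 < α) (hC : 0 < C) (ψ : SchwartzMap ℝ ℝ)
    (hψ : ∫ x, ψ x = 0) (hψ0 : ψ 0 ≠ 0) {s : ℝ} (hs : 1 / 2 < s) (hs1 : s ≤ 1) :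
    ∃ K c : ℝ, 0 < K ∧ 0 < c ∧ ∀ m n : ℕ, 0 < m → 0 < n → ∀ τ : ℝ,
      τ = m / (Real.log b - Real.log a) →
      ENNReal.ofReal (K * τ ^ (-(2 * α))) * blurredSize p ψ s τ ≤ (n : ℝ≥0∞)⁻¹ →
      ENNReal.ofReal (c * τ ^ (-(2 * α)))
        ≤ minimaxRisk a b p (expTransform '' holderDensities α C) n := by
  have hb : 0 < b := ha.trans hab
  set x₀ := Real.log a with hx₀
  set L := Real.log b - Real.log a with hLdef
  have hL : 0 < L := sub_pos.2 (Real.log_lt_log ha hab)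
  obtain ⟨g, hg, hgc, κ, B, hκ, hκB⟩ :=
    exists_heavyTailed_mem_holderDensities (C := C / 2) hα (half_pos hC) hs
  have hgm : Measurable g := hgc.continuous.measurable
  have hg0 : ∀ x, 0 ≤ g x := hg.1
  obtain ⟨κ', hκ', hlow⟩ := hp.exists_le_logMixture hgm hκ (by linarith) (fun x => (hκB x).1)
    fun x => (hκB x).2
  obtain ⟨c₀, hc₀, hpert⟩ := exists_perturbation_small ψ x₀ hL hα (half_pos hC) (half_pos hκ)
  set R := |x₀| + L with hR
  -- the bump exceeds half of its value at `0` on `[0, ρ)`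
  obtain ⟨ρ, hρ, hρ1, hψρ⟩ : ∃ ρ : ℝ, 0 < ρ ∧ ρ ≤ 1 ∧ ∀ y, 0 ≤ y → y < ρ → |ψ 0| / 2 ≤ |ψ y| := by
    have hcont : ContinuousAt (fun y => |ψ y|) 0 := ψ.continuous.abs.continuousAt
    have hev : ∀ᶠ y in 𝓝 (0 : ℝ), |ψ 0| / 2 < |ψ y| :=
      hcont.eventually (lt_mem_nhds (half_lt_self (abs_pos.2 hψ0)))
    obtain ⟨ε, hε, h⟩ := Metric.eventually_nhds_iff.1 hev
    refine ⟨min ε 1, lt_min hε one_pos, min_le_right _ _, fun y hy0 hy => (h ?_).le⟩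
    rw [Real.dist_eq, sub_zero, abs_of_nonneg hy0]
    exact hy.trans_le (min_le_left _ _)
  set q := |ψ 0| / 2 with hq
  have hq0 : 0 < q := half_pos (abs_pos.2 hψ0)
  refine ⟨c₀ ^ 2 * (κ' / 2)⁻¹ * (2 + 2 * R ^ 2) ^ s, (b⁻¹ * c₀ * q) ^ 2 * (a * ρ) * L / 16,
    by positivity, by positivity, fun m n hm hn τ hτ hsmall => ?_⟩
  have hm0 : (0 : ℝ) < m := by exact_mod_cast hm
  have hτ0 : 0 < τ := by rw [hτ]; positivity
  have hmτ : (m : ℝ) = τ * L := by rw [hτ, div_mul_cancel₀ _ hL.ne']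
  have hτα : 0 < τ ^ (-α) := Real.rpow_pos_of_pos hτ0 _
  have hτ2 : (τ ^ (-α)) ^ 2 = τ ^ (-(2 * α)) := by
    rw [← Real.rpow_natCast, ← Real.rpow_mul hτ0.le]; congr 1; push_cast; ring
  set G : (Fin m → Bool) → ℝ → ℝ := cubeDensity g ψ c₀ α τ x₀ with hG
  have hpert' := fun e => hpert m hm e
  rw [← hτ] at hpert'
  have hsmallg : ∀ (e : Fin m → Bool) x, |c₀ * τ ^ (-α) * bumpSum ψ e (τ * (x - x₀))| ≤ g x / 2 := by
    intro e x
    refine ((hpert' e).1 x).trans ?_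
    have h1 : (1 + x ^ 2)⁻¹ ≤ (1 + x ^ 2) ^ (-s) := by
      rw [← Real.rpow_neg_one]
      exact Real.rpow_le_rpow_of_exponent_le (by nlinarith [sq_nonneg x]) (by linarith)
    have h2 := (hκB x).1
    have h3 := mul_le_mul_of_nonneg_left h1 (half_pos hκ).le
    linarith
  have hPc : ∀ e : Fin m → Bool, ContDiff ℝ (⊤ : ℕ∞)
      fun x => c₀ * τ ^ (-α) * bumpSum ψ e (τ * (x - x₀)) := fun e =>
    contDiff_const.mul ((contDiff_bumpSum ψ e).comp
      (contDiff_const.mul (contDiff_id.sub contDiff_const)))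
  have hPi : ∀ e : Fin m → Bool,
      Integrable fun x => c₀ * τ ^ (-α) * bumpSum ψ e (τ * (x - x₀)) := fun e =>
    (((integrable_bumpSum ψ e).comp_mul_left' hτ0.ne').comp_sub_right x₀).const_mul _
  have hP0 : ∀ e : Fin m → Bool,
      ∫ x, c₀ * τ ^ (-α) * bumpSum ψ e (τ * (x - x₀)) = 0 := by
    intro e
    rw [integral_const_mul, integral_sub_right_eq_self (fun x => bumpSum ψ e (τ * x)) x₀,
      Measure.integral_comp_mul_left (bumpSum ψ e) τ, integral_bumpSum ψ hψ e, smul_zero, mul_zero]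
  have hGmem : ∀ e, G e ∈ holderDensities α C := by
    intro e
    have h := holderDensities_add (C₂ := C / 2) hg hgc (hPc e)
      (fun x => (hsmallg e x).trans (by linarith [hg0 x])) (hPi e) (hP0 e) (hpert' e).2
    rwa [add_halves] at h
  have hGm : ∀ e, Measurable (G e) := fun e => (hgc.add (hPc e)).continuous.measurable
  have hGlow : ∀ e x, g x / 2 ≤ G e x := by
    intro e x
    have := (abs_le.1 (hsmallg e x)).1
    simp only [hG, cubeDensity]
    linarith
  have hGB : ∀ e x, |G e x| ≤ 2 * B := by
    intro e x
    rw [abs_of_nonneg ((hGmem e).1 x)]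
    have := (abs_le.1 (hsmallg e x)).2
    have := (hκB x).2
    have := hg0 x
    simp only [hG, cubeDensity]
    linarith
  have hmixlow : ∀ e y, κ' / 2 * (1 + y ^ 2) ^ (-s) ≤ logMixture p (G e) y := by
    intro e y
    have h1 : logMixture p (fun x => g x / 2) y ≤ logMixture p (G e) y := by
      refine integral_mono (hp.integrable_logMixture (hgm.div_const 2) (B := B) (fun x => ?_) y)
        (hp.integrable_logMixture (hGm e) (hGB e) y)
        fun u => mul_le_mul_of_nonneg_right (hGlow e _) (hp.logDensity_nonneg u)
      rw [abs_of_nonneg (div_nonneg (hg0 x) zero_le_two)]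
      linarith [hg0 x, (hκB x).2]
    have h2 : logMixture p (fun x => g x / 2) y = logMixture p g y / 2 := by
      unfold logMixture
      rw [← integral_div]
      exact integral_congr_ae (ae_of_all _ fun u => by ring)
    linarith [hlow y]
  have hwpos : ∀ y : ℝ, 0 < (1 + y ^ 2) ^ (-s) := fun y => Real.rpow_pos_of_pos (by positivity) _
  have hmixpos : ∀ e y, 0 < logMixture p (G e) y := fun e y =>
    (mul_pos (half_pos hκ') (hwpos y)).trans_le (hmixlow e y)
  -- the images under `exp` of the intervals `[x₀ + j / τ, x₀ + (j + ρ) / τ)`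
  set J : Fin m → Set ℝ := fun j =>
    Ico (Real.exp (x₀ + j / τ)) (Real.exp (x₀ + (j + ρ) / τ)) with hJdef
  have hJlog : ∀ j, ∀ t ∈ J j, 0 < t ∧ (j : ℝ) ≤ τ * (Real.log t - x₀) ∧
      τ * (Real.log t - x₀) < j + ρ := by
    intro j t ht
    have ht0 : 0 < t := (Real.exp_pos _).trans_le ht.1
    have h1 := (Real.le_log_iff_exp_le ht0).2 ht.1
    have h2 := (Real.log_lt_iff_lt_exp ht0).2 ht.2
    refine ⟨ht0, ?_, ?_⟩
    · rw [mul_comm, ← div_le_iff₀ hτ0]; linarith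
    · rw [mul_comm, ← lt_div_iff₀ hτ0]; linarith
  have hJsub : ∀ j, J j ⊆ Icc a b := by
    intro j t ht
    obtain ⟨ht0, h1, h2⟩ := hJlog j t ht
    have hj : (j : ℝ) + 1 ≤ m := by exact_mod_cast j.2
    constructor
    · rw [← Real.log_le_log_iff ha ht0]
      have : 0 ≤ τ * (Real.log t - x₀) := (Nat.cast_nonneg _).trans h1
      linarith [nonneg_of_mul_nonneg_right this hτ0]
    · rw [← Real.log_le_log_iff ht0 hb]
      have : τ * (Real.log t - x₀) ≤ τ * L := by rw [← hmτ]; linarith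
      have := le_of_mul_le_mul_left this hτ0
      linarith
  have hJdisj : Pairwise fun i j => Disjoint (J i) (J j) := by
    intro i j hij
    rw [Set.disjoint_left]
    intro t hi hj
    obtain ⟨_, hi1, hi2⟩ := hJlog i t hi
    obtain ⟨_, hj1, hj2⟩ := hJlog j t hj
    have h1 : (i : ℝ) < j + 1 := by linarith
    have h2 : (j : ℝ) < i + 1 := by linarith
    have h1' : (i : ℕ) < j + 1 := by exact_mod_cast h1
    have h2' : (j : ℕ) < i + 1 := by exact_mod_cast h2
    exact hij (Fin.ext (by omega))
  have hJvol : ∀ j, ENNReal.ofReal (a * ρ / τ) ≤ volume (J j) := by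
    intro j
    rw [hJdef, Real.volume_Ico]
    refine ENNReal.ofReal_le_ofReal ?_
    rw [show x₀ + (j + ρ) / τ = (x₀ + j / τ) + ρ / τ by ring, Real.exp_add (x₀ + j / τ)]
    have h1 : a ≤ Real.exp (x₀ + j / τ) := by
      rw [← Real.log_le_iff_le_exp ha]
      have : 0 ≤ (j : ℝ) / τ := by positivity
      linarith
    have h2 := Real.add_one_le_exp (ρ / τ)
    have h3 : 0 < ρ / τ := by positivity
    rw [mul_div_assoc]
    nlinarith
  set D : ℝ := (b⁻¹ * (c₀ * τ ^ (-α)) * q) ^ 2 * (a * ρ / τ) with hD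
  have hmain := assouad_le_minimaxRisk (a := a) (b := b) (p := p)
    (F := expTransform '' holderDensities α C) hn (fun e => expTransform (G e))
    (fun e => mem_image_of_mem _ (hGmem e))
    (fun e => measurable_inv.mul ((hGm e).comp Real.measurable_log))
    J (fun j => measurableSet_Ico) hJdisj hJsub (ENNReal.ofReal D) ?_
    (fun e => hp.isProbabilityMeasure_mixtureMeasure (hGm e) (hGmem e).1 (hGB e) (hGmem e).2.1
      (hGmem e).2.2.1)
    (fun e j => hp.exists_likelihoodRatio (hGm e) (hGmem e).1 (hGB e) (hGmem e).2.1
      (hGmem e).2.2.1 (hGm _) (hGmem _).1 (hGB _) (hGmem _).2.1 (hGmem _).2.2.1 (hmixpos e) ?_)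
  · refine le_trans (le_of_eq ?_) hmain
    have h16 : (16 : ℝ≥0∞) = ENNReal.ofReal 16 := by norm_num
    rw [← ENNReal.ofReal_natCast, h16, ← ENNReal.ofReal_div_of_pos (by norm_num),
      ← ENNReal.ofReal_mul (Nat.cast_nonneg m)]
    congr 1
    rw [← hτ2, hD, hmτ]
    field_simp
  · intro e j
    refine ofReal_le_eLpNorm_sq measurableSet_Ico (by positivity) (fun t ht => ?_) (hJvol j)
    obtain ⟨ht0, h1, h2⟩ := hJlog j t ht
    have htb : t ≤ b := (hJsub j ht).2
    have hdiff : expTransform (G e) t - expTransform (G (flipBit j e)) t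
        = t⁻¹ * (c₀ * τ ^ (-α))
          * (-((if e j then -1 else 1) * ψ (τ * (Real.log t - x₀) - j))) := by
      rw [← bumpSum_flipBit_sub]
      simp only [expTransform, hG, cubeDensity]
      ring
    have hsign : |-((if e j then -1 else 1) * ψ (τ * (Real.log t - x₀) - j))|
        = |ψ (τ * (Real.log t - x₀) - j)| := by
      cases e j <;> simp
    rw [hdiff, abs_mul, hsign, abs_of_pos (by positivity)]
    have := hψρ (τ * (Real.log t - x₀) - j) (by linarith) (by linarith)
    gcongr
  · have hjR : |x₀ + j / τ| ≤ R := by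
      refine (abs_add_le _ _).trans ?_
      rw [hR]
      gcongr
      have hj : (j : ℝ) ≤ m := by exact_mod_cast j.2.le
      rw [abs_of_nonneg (by positivity), div_le_iff₀ hτ0, mul_comm, ← hmτ]
      exact hj
    refine le_trans ?_ hsmall
    set W := logMixture p fun x => ψ (τ * x) with hW
    calc ∫⁻ y, ENNReal.ofReal ((logMixture p (G (flipBit j e)) y - logMixture p (G e) y) ^ 2
          / logMixture p (G e) y)
        ≤ ∫⁻ y, ENNReal.ofReal ((c₀ * τ ^ (-α)) ^ 2 * (κ' / 2)⁻¹)
            * ENNReal.ofReal (W (y - (x₀ + j / τ)) ^ 2 * (1 + y ^ 2) ^ s) := by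
          refine lintegral_mono fun y => ?_
          rw [← ENNReal.ofReal_mul (by positivity)]
          refine ENNReal.ofReal_le_ofReal ?_
          rw [hG, logMixture_cubeDensity_flipBit_sub hp hτ0.ne' e j hGm hGB y, mul_pow, mul_pow]
          have h1 : ((if e j then -1 else 1 : ℝ)) ^ 2 = 1 := by cases e j <;> simp
          rw [h1, one_mul]
          have h2 := hmixlow e y
          have h3 : 0 < κ' / 2 * (1 + y ^ 2) ^ (-s) := mul_pos (half_pos hκ') (hwpos y)
          calc (c₀ * τ ^ (-α)) ^ 2 * W (y - (x₀ + j / τ)) ^ 2 / logMixture p (G e) y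
              ≤ (c₀ * τ ^ (-α)) ^ 2 * W (y - (x₀ + j / τ)) ^ 2
                / (κ' / 2 * (1 + y ^ 2) ^ (-s)) := by gcongr
            _ = _ := by
              have h4 : (1 + y ^ 2) ^ (-s) = ((1 + y ^ 2) ^ s)⁻¹ := Real.rpow_neg (by positivity) s
              rw [h4, div_eq_mul_inv, mul_inv _ ((1 + y ^ 2) ^ s)⁻¹, inv_inv]
              ring
      _ ≤ ENNReal.ofReal ((c₀ * τ ^ (-α)) ^ 2 * (κ' / 2)⁻¹)
            * (ENNReal.ofReal ((2 + 2 * R ^ 2) ^ s) * blurredSize p ψ s τ) := by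
          rw [lintegral_const_mul' _ _ ENNReal.ofReal_ne_top]
          gcongr
          exact lintegral_shift_sq_mul_le (by linarith) hjR
      _ = _ := by
          rw [← mul_assoc, ← ENNReal.ofReal_mul (by positivity), mul_pow, hτ2]
          congr 2
          ring

/-! ### A bump whose Fourier transform lives away from the origin -/

open scoped FourierTransform

/-- A smooth bump supported in the frequency band `[1, 2]`. -/
noncomputable def freqBump : ContDiffBump (3 / 2 : ℝ) where
  rIn := 1 / 4
  rOut := 1 / 2
  rIn_pos := by norm_num
  rIn_lt_rOut := by norm_num

theorem freqBump_eq_zero {v : ℝ} (hv : v ≤ 1 ∨ 2 ≤ v) : freqBump v = 0 := by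
  refine freqBump.zero_of_le_dist ?_
  change (1 / 2 : ℝ) ≤ dist v (3 / 2)
  rw [Real.dist_eq]
  rcases hv with h | h
  · rw [abs_of_nonpos (by linarith)]; linarith
  · rw [abs_of_nonneg (by linarith)]; linarith

theorem contDiff_ofReal_freqBump : ContDiff ℝ (⊤ : ℕ∞) fun v => (freqBump v : ℂ) :=
  Complex.ofRealCLM.contDiff.comp freqBump.contDiff

theorem hasCompactSupport_ofReal_freqBump : HasCompactSupport fun v => (freqBump v : ℂ) :=
  freqBump.hasCompactSupport.comp_left (g := fun r : ℝ => (r : ℂ)) Complex.ofReal_zero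

/-- The bump `freqBump` as a complex-valued Schwartz function. -/
noncomputable def freqSchwartz : SchwartzMap ℝ ℂ :=
  hasCompactSupport_ofReal_freqBump.toSchwartzMap contDiff_ofReal_freqBump

theorem freqSchwartz_apply (v : ℝ) : freqSchwartz v = (freqBump v : ℂ) := rfl

/-- The real part of the Fourier transform of `freqBump`, a Schwartz function without low
frequencies. -/
noncomputable def oscBump : SchwartzMap ℝ ℝ :=
  SchwartzMap.postcompCLM Complex.reCLM (𝓕 freqSchwartz)

theorem oscBump_apply (y : ℝ) : oscBump y = (𝓕 (freqSchwartz : ℝ → ℂ) y).re := by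
  rw [← SchwartzMap.fourier_coe]; rfl

theorem oscBump_zero_ne_zero : oscBump 0 ≠ 0 := by
  rw [oscBump_apply, Real.fourier_real_eq_integral_exp_smul]
  have h : ∀ v : ℝ, Complex.exp (((-2 * Real.pi * v * 0 : ℝ) : ℂ) * Complex.I) • freqSchwartz v
      = ((freqBump v : ℝ) : ℂ) := by
    intro v; simp [freqSchwartz_apply]
  simp_rw [h]
  rw [integral_complex_ofReal, Complex.ofReal_re]
  exact freqBump.integral_pos.ne'

theorem integral_oscBump : ∫ x, oscBump x = 0 := by
  have h : 𝓕⁻ (𝓕 freqSchwartz : SchwartzMap ℝ ℂ) = freqSchwartz :=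
    FourierPair.fourierInv_fourier_eq freqSchwartz
  have h0 : (𝓕⁻ ((𝓕 freqSchwartz : SchwartzMap ℝ ℂ) : ℝ → ℂ)) 0 = freqSchwartz 0 := by
    rw [← SchwartzMap.fourierInv_coe, h]
  rw [freqSchwartz_apply, freqBump_eq_zero (Or.inl zero_le_one), Complex.ofReal_zero,
    Real.fourierInv_eq'] at h0
  simp only [inner_zero_right, mul_zero, Complex.ofReal_zero, zero_mul, Complex.exp_zero,
    one_smul] at h0
  have hre : ∫ x, oscBump x = (∫ x, (𝓕 freqSchwartz : SchwartzMap ℝ ℂ) x).re :=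
    integral_re (𝕜 := ℂ) (𝓕 freqSchwartz : SchwartzMap ℝ ℂ).integrable
  rw [hre, h0, Complex.zero_re]

/-! ### Convolution with the density of `log Y` in the frequency domain -/

theorem logCharFun_eq (p : ℝ → ℝ) (ξ : ℝ) :
    logCharFun p ξ = ∫ u : ℝ, Complex.exp ((ξ * u : ℝ) * Complex.I) * (logDensity p u : ℂ) := by
  refine integral_congr_ae (ae_of_all _ fun u => ?_)
  simp only [logDensity]
  push_cast
  rw [show (u : ℂ) + Complex.I * ξ * u = (ξ * u) * Complex.I + u by ring, Complex.exp_add]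
  ring

/-- The Fourier transform of a rescaled bump after convolution with the density of `log Y`. -/
noncomputable def blurredFourier (p : ℝ → ℝ) (τ v : ℝ) : ℂ :=
  freqBump v * logCharFun p (2 * Real.pi * τ * v)

theorem IsDensityOnPos.logMixture_oscBump {p : ℝ → ℝ} (hp : IsDensityOnPos p) (τ z : ℝ) :
    logMixture p (fun x => oscBump (τ * x)) z = (𝓕 (blurredFourier p τ) (τ * z)).re := by
  have hq := hp.integrable_logDensity.ofReal (𝕜 := ℂ)
  set K : ℝ → ℝ → ℂ := fun u v =>
    Complex.exp (((-2 * Real.pi * v * (τ * (z - u)) : ℝ) : ℂ) * Complex.I)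
      * (freqSchwartz v * (logDensity p u : ℂ)) with hK
  have hKi : Integrable (Function.uncurry K) (volume.prod volume) := by
    have h1 : Integrable (fun x : ℝ × ℝ => freqSchwartz x.2 * (logDensity p x.1 : ℂ))
        (volume.prod volume) := by
      have hs : Integrable (freqSchwartz : ℝ → ℂ) volume := freqSchwartz.integrable
      have := hq.mul_prod hs
      exact this.congr (ae_of_all _ fun x => mul_comm _ _)
    refine h1.bdd_mul (c := 1) ?_ (ae_of_all _ fun x => ?_)
    · refine Continuous.aestronglyMeasurable ?_
      fun_prop
    · rw [Complex.norm_exp_ofReal_mul_I]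
  have hinner : ∀ u, ∫ v, K u v = 𝓕 (freqSchwartz : ℝ → ℂ) (τ * (z - u)) * (logDensity p u : ℂ) := by
    intro u
    rw [Real.fourier_real_eq_integral_exp_smul, ← integral_mul_const]
    refine integral_congr_ae (ae_of_all _ fun v => ?_)
    simp only [hK, smul_eq_mul]
    ring
  have houter : ∀ v, ∫ u, K u v
      = Complex.exp (((-2 * Real.pi * v * (τ * z) : ℝ) : ℂ) * Complex.I)
        • blurredFourier p τ v := by
    intro v
    rw [blurredFourier, logCharFun_eq, smul_eq_mul, ← integral_const_mul, ← integral_const_mul]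
    refine integral_congr_ae (ae_of_all _ fun u => ?_)
    simp only [hK, freqSchwartz_apply]
    rw [show ((-2 * Real.pi * v * (τ * (z - u)) : ℝ) : ℂ) * Complex.I
      = ((-2 * Real.pi * v * (τ * z) : ℝ) : ℂ) * Complex.I
        + ((2 * Real.pi * τ * v * u : ℝ) : ℂ) * Complex.I by push_cast; ring, Complex.exp_add]
    ring
  have hswap := integral_integral_swap hKi
  simp_rw [hinner, houter] at hswap
  rw [Real.fourier_real_eq_integral_exp_smul, ← hswap]
  have hi : Integrable fun u => 𝓕 (freqSchwartz : ℝ → ℂ) (τ * (z - u)) * (logDensity p u : ℂ) := by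
    have := hKi.integral_prod_left
    exact this.congr (ae_of_all _ hinner)
  refine Eq.trans ?_ (integral_re (𝕜 := ℂ) hi)
  refine integral_congr_ae (ae_of_all _ fun u => ?_)
  change oscBump (τ * (z - u)) * logDensity p u = (_ * (logDensity p u : ℂ)).re
  rw [oscBump_apply, Complex.re_mul_ofReal]

theorem norm_fourier_le_of_support {G : ℝ → ℂ} {A : ℝ}
    (hG : ∀ v ∈ Icc (1 : ℝ) 2, ‖G v‖ ≤ A) (hG0 : ∀ v ∉ Icc (1 : ℝ) 2, G v = 0) (y : ℝ) :
    ‖𝓕 G y‖ ≤ A := by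
  rw [Real.fourier_real_eq_integral_exp_smul]
  refine (norm_integral_le_of_norm_le (g := (Icc (1 : ℝ) 2).indicator fun _ => A) ?_
    (ae_of_all _ fun v => ?_)).trans ?_
  · exact (integrable_indicator_iff measurableSet_Icc).2 (by simp)
  · rw [norm_smul, Complex.norm_exp_ofReal_mul_I, one_mul]
    by_cases hv : v ∈ Icc (1 : ℝ) 2
    · rw [indicator_of_mem hv]; exact hG v hv
    · rw [indicator_of_notMem hv, hG0 v hv, norm_zero]
  · rw [integral_indicator measurableSet_Icc, setIntegral_const]
    norm_num [Measure.real]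

/-! ### Polynomially decaying characteristic functions -/

theorem hasDerivAt_mul_of_eq_zero_of_le {e e' F F' : ℝ → ℂ} (he : ∀ v, HasDerivAt e (e' v) v)
    (h0 : ∀ v ≤ 1, e v = 0) (h0' : ∀ v ≤ 1, e' v = 0) (hF : ∀ v, 1 ≤ v → HasDerivAt F (F' v) v)
    (v : ℝ) : HasDerivAt (fun v => e v * F v) (e' v * F v + e v * F' v) v := by
  rcases le_or_gt 1 v with hv | hv
  · exact (he v).mul (hF v hv)
  · rw [h0 v hv.le, h0' v hv.le, zero_mul, zero_mul, zero_add]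
    refine (hasDerivAt_const v (0 : ℂ)).congr_of_eventuallyEq ?_
    filter_upwards [gt_mem_nhds hv] with w hw
    rw [h0 w hw.le, zero_mul]

theorem deriv_eq_zero_of_eq_zero_off_Ioo {e : ℝ → ℂ}
    (h0 : ∀ v, v ≤ 1 ∨ 2 ≤ v → e v = 0) (hc : Continuous (deriv e)) :
    ∀ v, v ≤ 1 ∨ 2 ≤ v → deriv e v = 0 := by
  have hopen : ∀ v, v < 1 ∨ 2 < v → deriv e v = 0 := by
    intro v hv
    have : e =ᶠ[𝓝 v] fun _ => 0 := by
      rcases hv with h | h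
      · filter_upwards [gt_mem_nhds h] with w hw using h0 w (Or.inl hw.le)
      · filter_upwards [lt_mem_nhds h] with w hw using h0 w (Or.inr hw.le)
    rw [this.deriv_eq, deriv_const]
  have hclosed : IsClosed {v | deriv e v = 0} := isClosed_eq hc continuous_const
  intro v hv
  rcases hv with h | h
  · have : closure (Iio (1 : ℝ)) ⊆ {v | deriv e v = 0} :=
      closure_minimal (fun w hw => hopen w (Or.inl hw)) hclosed
    rw [closure_Iio] at this
    exact this h
  · have : closure (Ioi (2 : ℝ)) ⊆ {v | deriv e v = 0} :=
      closure_minimal (fun w hw => hopen w (Or.inr hw)) hclosed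
    rw [closure_Ioi] at this
    exact this h

theorem integrable_of_norm_le_Icc {G : ℝ → ℂ} (hm : AEStronglyMeasurable G volume) {A : ℝ}
    (hG : ∀ v ∈ Icc (1 : ℝ) 2, ‖G v‖ ≤ A) (hG0 : ∀ v ∉ Icc (1 : ℝ) 2, G v = 0) :
    Integrable G := by
  have hi : Integrable ((Icc (1 : ℝ) 2).indicator fun _ => A) :=
    (integrable_indicator_iff measurableSet_Icc).2 (by simp)
  refine hi.mono' hm (ae_of_all _ fun v => ?_)
  by_cases hv : v ∈ Icc (1 : ℝ) 2
  · rw [indicator_of_mem hv]; exact hG v hv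
  · rw [indicator_of_notMem hv, hG0 v hv, norm_zero]

/-- Two integrations by parts for a function supported in the frequency band `[1, 2]`. -/
theorem one_add_sq_mul_norm_fourier_le {G G₁ G₂ : ℝ → ℂ} {A : ℝ}
    (hG₁ : ∀ v, HasDerivAt G (G₁ v) v) (hG₂ : ∀ v, HasDerivAt G₁ (G₂ v) v)
    (hA : ∀ v ∈ Icc (1 : ℝ) 2, ‖G v‖ ≤ A ∧ ‖G₁ v‖ ≤ A ∧ ‖G₂ v‖ ≤ A)
    (h0 : ∀ v ∉ Icc (1 : ℝ) 2, G v = 0 ∧ G₁ v = 0 ∧ G₂ v = 0) (y : ℝ) :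
    (1 + y ^ 2) * ‖𝓕 G y‖ ≤ 2 * A := by
  have hd1 : deriv G = G₁ := funext fun v => (hG₁ v).deriv
  have hd2 : deriv G₁ = G₂ := funext fun v => (hG₂ v).deriv
  have hD : Differentiable ℝ G := fun v => (hG₁ v).differentiableAt
  have hD1 : Differentiable ℝ G₁ := fun v => (hG₂ v).differentiableAt
  have hm2 : AEStronglyMeasurable G₂ volume := by
    rw [← hd2]; exact aestronglyMeasurable_deriv _ _
  have hi := integrable_of_norm_le_Icc hD.continuous.aestronglyMeasurable
    (fun v hv => (hA v hv).1) fun v hv => (h0 v hv).1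
  have hi1 := integrable_of_norm_le_Icc hD1.continuous.aestronglyMeasurable
    (fun v hv => (hA v hv).2.1) fun v hv => (h0 v hv).2.1
  have hi2 := integrable_of_norm_le_Icc hm2
    (fun v hv => (hA v hv).2.2) fun v hv => (h0 v hv).2.2
  have e1 := congrFun (Real.fourier_deriv hi hD (by rw [hd1]; exact hi1)) y
  have e2 := congrFun (Real.fourier_deriv hi1 hD1 (by rw [hd2]; exact hi2)) y
  rw [hd1] at e1
  rw [hd2] at e2
  have b0 := norm_fourier_le_of_support (fun v hv => (hA v hv).1) (fun v hv => (h0 v hv).1) y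
  have b2 := norm_fourier_le_of_support (fun v hv => (hA v hv).2.2)
    (fun v hv => (h0 v hv).2.2) y
  rw [e2] at b2
  simp only [e1, norm_smul] at b2
  have hn : ‖2 * (Real.pi : ℂ) * Complex.I * y‖ = 2 * Real.pi * |y| := by
    simp [abs_of_pos Real.pi_pos]
  rw [hn, ← mul_assoc] at b2
  have hpi : 1 ≤ 2 * Real.pi := by linarith [Real.pi_gt_three]
  have hsq : y ^ 2 ≤ 2 * Real.pi * |y| * (2 * Real.pi * |y|) := by
    have : 2 * Real.pi * |y| * (2 * Real.pi * |y|) = (2 * Real.pi) ^ 2 * y ^ 2 := by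
      rw [← sq_abs y]; ring
    rw [this]
    exact le_mul_of_one_le_left (sq_nonneg y) (one_le_pow₀ hpi)
  have := mul_le_mul_of_nonneg_right hsq (norm_nonneg (𝓕 G y))
  linarith

theorem IsDensityOnPos.abs_logMixture_oscBump_le {p : ℝ → ℝ} (hp : IsDensityOnPos p) (τ z : ℝ) :
    |logMixture p (fun x => oscBump (τ * x)) z| ≤ ‖𝓕 (blurredFourier p τ) (τ * z)‖ := by
  rw [hp.logMixture_oscBump]
  exact Complex.abs_re_le_norm _

theorem rpow_mul_le_two_rpow_abs {v r : ℝ} (hv : v ∈ Icc (1 : ℝ) 2) : v ^ r ≤ 2 ^ |r| :=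
  (Real.rpow_le_rpow_of_exponent_le hv.1 (le_abs_self r)).trans
    (Real.rpow_le_rpow (zero_le_one.trans hv.1) hv.2 (abs_nonneg r))

theorem exists_norm_le_of_isBigO_cocompact {f : ℝ → ℂ} {g : ℝ → ℝ} (h : f =O[cocompact ℝ] g) :
    ∃ K X : ℝ, 0 < K ∧ ∀ x, X ≤ x → ‖f x‖ ≤ K * ‖g x‖ := by
  have h' : f =O[atTop] g := h.mono atTop_le_cocompact
  obtain ⟨K, hK, hb⟩ := h'.exists_pos
  obtain ⟨X, hX⟩ := eventually_atTop.1 hb.bound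
  exact ⟨K, X, hK, hX⟩

theorem exists_blurredFourier_decay {p : ℝ → ℝ} {β : ℝ}
    (hdiff : ∀ᶠ ξ in cocompact ℝ, ∀ j < 2, DifferentiableAt ℝ (iteratedDeriv j (logCharFun p)) ξ)
    (hO : ∀ j ≤ 2, iteratedDeriv j (logCharFun p)
      =O[cocompact ℝ] fun ξ : ℝ => |ξ| ^ (-β - (j : ℝ))) :
    ∃ A τ₀ : ℝ, 0 < A ∧ 1 ≤ τ₀ ∧ ∀ τ, τ₀ ≤ τ → ∀ y,
      (1 + y ^ 2) * ‖𝓕 (blurredFourier p τ) y‖ ≤ A * τ ^ (-β) := by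
  set φ := logCharFun p with hφ
  obtain ⟨X, hX⟩ := eventually_atTop.1 (hdiff.filter_mono atTop_le_cocompact)
  obtain ⟨K₀, X₀, hK₀, h₀⟩ := exists_norm_le_of_isBigO_cocompact (hO 0 (by norm_num))
  obtain ⟨K₁, X₁, hK₁, h₁⟩ := exists_norm_le_of_isBigO_cocompact (hO 1 (by norm_num))
  obtain ⟨K₂, X₂, hK₂, h₂⟩ := exists_norm_le_of_isBigO_cocompact (hO 2 le_rfl)
  set K := K₀ + K₁ + K₂ with hK
  have hKpos : 0 < K := by positivity
  -- the cutoff and its first two derivatives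
  set e : ℝ → ℂ := fun v => (freqBump v : ℂ) with he
  have hec : ContDiff ℝ (⊤ : ℕ∞) e := contDiff_ofReal_freqBump
  have hec1 : ContDiff ℝ (⊤ : ℕ∞) (deriv e) := by
    have := hec.iterate_deriv 1; simpa using this
  have hec2 : ContDiff ℝ (⊤ : ℕ∞) (deriv (deriv e)) := by
    have := hec1.iterate_deriv 1; simpa using this
  have htop : ((⊤ : ℕ∞) : WithTop ℕ∞) ≠ 0 := by simp
  have ed : Differentiable ℝ e := hec.differentiable htop
  have ed1 : Differentiable ℝ (deriv e) := hec1.differentiable htop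
  have e0 : ∀ v, v ≤ 1 ∨ 2 ≤ v → e v = 0 := fun v hv => by
    simp only [he]; rw [freqBump_eq_zero hv, Complex.ofReal_zero]
  have e1 := deriv_eq_zero_of_eq_zero_off_Ioo e0 hec1.continuous
  have e2 := deriv_eq_zero_of_eq_zero_off_Ioo e1 hec2.continuous
  obtain ⟨E₀, hE₀⟩ := isCompact_Icc.exists_bound_of_continuousOn (s := Icc (1 : ℝ) 2)
    hec.continuous.continuousOn
  obtain ⟨E₁, hE₁⟩ := isCompact_Icc.exists_bound_of_continuousOn (s := Icc (1 : ℝ) 2)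
    hec1.continuous.continuousOn
  obtain ⟨E₂, hE₂⟩ := isCompact_Icc.exists_bound_of_continuousOn (s := Icc (1 : ℝ) 2)
    hec2.continuous.continuousOn
  set E := |E₀| + |E₁| + |E₂| with hE
  have hE0 : 0 ≤ E := by positivity
  have hb0 : ∀ v ∈ Icc (1 : ℝ) 2, ‖e v‖ ≤ E := fun v hv => by
    linarith [hE₀ v hv, le_abs_self E₀, abs_nonneg E₁, abs_nonneg E₂]
  have hb1 : ∀ v ∈ Icc (1 : ℝ) 2, ‖deriv e v‖ ≤ E := fun v hv => by
    linarith [hE₁ v hv, le_abs_self E₁, abs_nonneg E₀, abs_nonneg E₂]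
  have hb2 : ∀ v ∈ Icc (1 : ℝ) 2, ‖deriv (deriv e) v‖ ≤ E := fun v hv => by
    linarith [hE₂ v hv, le_abs_self E₂, abs_nonneg E₁, abs_nonneg E₀]
  set T := (2 * Real.pi) ^ (-β) with hT
  have hTpos : 0 < T := Real.rpow_pos_of_pos (by positivity) _
  set M := K * 2 ^ |β| with hM
  have hMpos : 0 < M := mul_pos hKpos (Real.rpow_pos_of_pos two_pos _)
  refine ⟨2 * (4 * (E + 1) * M * T), max 1 (|X| + |X₀| + |X₁| + |X₂|), by positivity,
    le_max_left _ _, fun τ hτ y => ?_⟩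
  have hτ1 : 1 ≤ τ := (le_max_left _ _).trans hτ
  have hτX : |X| + |X₀| + |X₁| + |X₂| ≤ τ := (le_max_right _ _).trans hτ
  set σ := 2 * Real.pi * τ with hσ
  have hστ : τ ≤ σ := by
    rw [hσ]; exact le_mul_of_one_le_left (by linarith) (by linarith [Real.pi_gt_three])
  have hσ0 : 0 < σ := by linarith
  have hσβ : σ ^ (-β) = T * τ ^ (-β) := by
    rw [hσ, Real.mul_rpow (by positivity) (by linarith)]
  have hbig : ∀ v : ℝ, 1 ≤ v → |X| + |X₀| + |X₁| + |X₂| ≤ σ * v := fun v hv =>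
    (hτX.trans hστ).trans (le_mul_of_one_le_right hσ0.le hv)
  have hb : ∀ (j : ℕ) (v : ℝ), v ∈ Icc (1 : ℝ) 2 →
      ‖iteratedDeriv j φ (σ * v)‖ ≤ K * ‖|σ * v| ^ (-β - (j : ℝ))‖ →
      ‖(σ : ℂ) ^ j * iteratedDeriv j φ (σ * v)‖ ≤ M * σ ^ (-β) := by
    intro j v hv hle
    have hv0 : 0 < v := by linarith [hv.1]
    have hσv : 0 < σ * v := by positivity
    rw [Real.norm_of_nonneg (Real.rpow_nonneg (abs_nonneg _) _), abs_of_pos hσv,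
      Real.mul_rpow hσ0.le hv0.le, Real.rpow_sub hσ0, Real.rpow_natCast] at hle
    have hvle : v ^ (-β - (j : ℝ)) ≤ 2 ^ |β| := by
      calc v ^ (-β - (j : ℝ)) ≤ v ^ (-β) :=
            Real.rpow_le_rpow_of_exponent_le hv.1 (by linarith [Nat.cast_nonneg (α := ℝ) j])
        _ ≤ 2 ^ |(-β)| := rpow_mul_le_two_rpow_abs hv
        _ = 2 ^ |β| := by rw [abs_neg]
    rw [norm_mul, norm_pow, Complex.norm_real, Real.norm_of_nonneg hσ0.le]
    calc σ ^ j * ‖iteratedDeriv j φ (σ * v)‖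
        ≤ σ ^ j * (K * (σ ^ (-β) / σ ^ j * v ^ (-β - (j : ℝ)))) := by gcongr
      _ = K * v ^ (-β - (j : ℝ)) * σ ^ (-β) := by
          have : σ ^ j ≠ 0 := (pow_pos hσ0 j).ne'
          field_simp
      _ ≤ K * 2 ^ |β| * σ ^ (-β) := by
          have := Real.rpow_pos_of_pos hσ0 (-β)
          gcongr
  have f0 : ∀ v ∈ Icc (1 : ℝ) 2, ‖φ (σ * v)‖ ≤ M * σ ^ (-β) := by
    intro v hv
    have := hb 0 v hv ((h₀ (σ * v) (by
      linarith [hbig v hv.1, le_abs_self X₀, abs_nonneg X, abs_nonneg X₁, abs_nonneg X₂])).trans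
      (by gcongr; linarith))
    simpa using this
  have f1 : ∀ v ∈ Icc (1 : ℝ) 2, ‖(σ : ℂ) * iteratedDeriv 1 φ (σ * v)‖ ≤ M * σ ^ (-β) := by
    intro v hv
    have := hb 1 v hv ((h₁ (σ * v) (by
      linarith [hbig v hv.1, le_abs_self X₁, abs_nonneg X, abs_nonneg X₀, abs_nonneg X₂])).trans
      (by gcongr; linarith))
    simpa using this
  have f2 : ∀ v ∈ Icc (1 : ℝ) 2, ‖(σ : ℂ) ^ 2 * iteratedDeriv 2 φ (σ * v)‖ ≤ M * σ ^ (-β) := by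
    intro v hv
    exact hb 2 v hv ((h₂ (σ * v) (by
      linarith [hbig v hv.1, le_abs_self X₂, abs_nonneg X, abs_nonneg X₀, abs_nonneg X₁])).trans
      (by gcongr; linarith))
  -- the derivatives of `v ↦ φ (σ v)` on the band
  have hdF : ∀ j < 2, ∀ v, 1 ≤ v → HasDerivAt (fun v : ℝ => (σ : ℂ) ^ j * iteratedDeriv j φ (σ * v))
      ((σ : ℂ) ^ (j + 1) * iteratedDeriv (j + 1) φ (σ * v)) v := by
    intro j hj v hv
    have hx := hX (σ * v) (by
      linarith [hbig v hv, le_abs_self X, abs_nonneg X₀, abs_nonneg X₁, abs_nonneg X₂]) j hj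
    have h1 : HasDerivAt (fun v : ℝ => σ * v) σ v := by
      simpa using (hasDerivAt_id v).const_mul σ
    have h2 := (hx.hasDerivAt.scomp v h1).const_mul ((σ : ℂ) ^ j)
    refine h2.congr_deriv ?_
    rw [iteratedDeriv_succ, Complex.real_smul, pow_succ]
    ring
  set F : ℕ → ℝ → ℂ := fun j v => (σ : ℂ) ^ j * iteratedDeriv j φ (σ * v) with hF
  have d0 := hasDerivAt_mul_of_eq_zero_of_le (F := F 0) (F' := F 1) (fun v => (ed v).hasDerivAt)
    (fun v hv => e0 v (Or.inl hv)) (fun v hv => e1 v (Or.inl hv)) (hdF 0 (by norm_num))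
  have d1 := hasDerivAt_mul_of_eq_zero_of_le (F := F 0) (F' := F 1) (fun v => (ed1 v).hasDerivAt)
    (fun v hv => e1 v (Or.inl hv)) (fun v hv => e2 v (Or.inl hv)) (hdF 0 (by norm_num))
  have d2 := hasDerivAt_mul_of_eq_zero_of_le (F := F 1) (F' := F 2) (fun v => (ed v).hasDerivAt)
    (fun v hv => e0 v (Or.inl hv)) (fun v hv => e1 v (Or.inl hv)) (hdF 1 (by norm_num))
  have hG : blurredFourier p τ = fun v => e v * F 0 v := by
    funext v
    simp only [blurredFourier, he, hF, pow_zero, one_mul, iteratedDeriv_zero]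
    rfl
  rw [hG]
  have g0 : ∀ v ∈ Icc (1 : ℝ) 2, ‖F 0 v‖ ≤ M * σ ^ (-β) := by simpa [hF] using f0
  have g1 : ∀ v ∈ Icc (1 : ℝ) 2, ‖F 1 v‖ ≤ M * σ ^ (-β) := by simpa [hF] using f1
  have g2 : ∀ v ∈ Icc (1 : ℝ) 2, ‖F 2 v‖ ≤ M * σ ^ (-β) := f2
  set Q := M * σ ^ (-β) with hQ
  have hQ0 : 0 ≤ Q := mul_nonneg hMpos.le (Real.rpow_nonneg hσ0.le _)
  have hprod : ∀ {x y : ℂ}, ‖x‖ ≤ E → ‖y‖ ≤ Q → ‖x * y‖ ≤ E * Q := fun hx hy => by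
    rw [norm_mul]; gcongr
  have hEQ : 0 ≤ E * Q := mul_nonneg hE0 hQ0
  have hfin := one_add_sq_mul_norm_fourier_le (A := 4 * (E * Q)) d0 (fun v => (d1 v).add (d2 v))
    (fun v hv => ?_) (fun v hv => ?_) y
  · refine hfin.trans ?_
    rw [hQ, hσβ]
    have : 0 ≤ M * (T * τ ^ (-β)) :=
      mul_nonneg hMpos.le (mul_nonneg hTpos.le (Real.rpow_nonneg (by linarith) _))
    nlinarith
  · have a00 := hprod (hb0 v hv) (g0 v hv)
    have a10 := hprod (hb1 v hv) (g0 v hv)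
    have a01 := hprod (hb0 v hv) (g1 v hv)
    have a20 := hprod (hb2 v hv) (g0 v hv)
    have a11 := hprod (hb1 v hv) (g1 v hv)
    have a02 := hprod (hb0 v hv) (g2 v hv)
    refine ⟨by linarith, (norm_add_le _ _).trans (by linarith), ?_⟩
    refine (norm_add_le _ _).trans ?_
    linarith [norm_add_le (deriv (deriv e) v * F 0 v) (deriv e v * F 1 v),
      norm_add_le (deriv e v * F 1 v) (e v * F 2 v)]
  · have hv' : v ≤ 1 ∨ 2 ≤ v := by
      rw [mem_Icc, not_and_or, not_le, not_le] at hv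
      exact hv.imp le_of_lt le_of_lt
    rw [e0 v hv', e1 v hv', e2 v hv']
    simp

theorem IsDensityOnPos.exists_blurredSize_le_rpow {p : ℝ → ℝ} (hp : IsDensityOnPos p) {β : ℝ}
    (hdiff : ∀ᶠ ξ in cocompact ℝ, ∀ j < 2, DifferentiableAt ℝ (iteratedDeriv j (logCharFun p)) ξ)
    (hO : ∀ j ≤ 2, iteratedDeriv j (logCharFun p)
      =O[cocompact ℝ] fun ξ : ℝ => |ξ| ^ (-β - (j : ℝ))) :
    ∃ A τ₀ : ℝ, 0 < A ∧ 1 ≤ τ₀ ∧ ∀ τ, τ₀ ≤ τ →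
      blurredSize p oscBump 1 τ ≤ ENNReal.ofReal (A * τ ^ (-(2 * β + 1))) := by
  obtain ⟨A, τ₀, hA, hτ₀, hdecay⟩ := exists_blurredFourier_decay hdiff hO
  refine ⟨A ^ 2 * Real.pi, τ₀, by positivity, hτ₀, fun τ hτ => ?_⟩
  have hτ1 : 1 ≤ τ := hτ₀.trans hτ
  have hτ0 : 0 < τ := by linarith
  have hτβ : 0 < τ ^ (-β) := Real.rpow_pos_of_pos hτ0 _
  have hint : Integrable fun z : ℝ => (A * τ ^ (-β)) ^ 2 * (1 + (τ * z) ^ 2)⁻¹ :=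
    (integrable_inv_one_add_sq.comp_mul_left' hτ0.ne').const_mul _
  calc blurredSize p oscBump 1 τ
      ≤ ∫⁻ z, ENNReal.ofReal ((A * τ ^ (-β)) ^ 2 * (1 + (τ * z) ^ 2)⁻¹) := by
        refine lintegral_mono fun z => ENNReal.ofReal_le_ofReal ?_
        have hW := hp.abs_logMixture_oscBump_le τ z
        have hd := hdecay τ hτ (τ * z)
        set W := logMixture p (fun x => oscBump (τ * x)) z
        set D := 1 + (τ * z) ^ 2 with hD
        have hD0 : 0 < D := by positivity
        have h1 : D * |W| ≤ A * τ ^ (-β) := (mul_le_mul_of_nonneg_left hW hD0.le).trans hd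
        have h2 : 1 + z ^ 2 ≤ D := by
          rw [hD, mul_pow]
          have := le_mul_of_one_le_left (sq_nonneg z) (one_le_pow₀ hτ1 (n := 2))
          linarith
        have h3 : (D * |W|) ^ 2 ≤ (A * τ ^ (-β)) ^ 2 := by gcongr
        rw [Real.rpow_one, ← div_eq_mul_inv, le_div_iff₀ hD0]
        calc W ^ 2 * (1 + z ^ 2) * D ≤ W ^ 2 * D * D := by gcongr
          _ = (D * |W|) ^ 2 := by rw [mul_pow, sq_abs]; ring
          _ ≤ _ := h3
    _ = ENNReal.ofReal (∫ z, (A * τ ^ (-β)) ^ 2 * (1 + (τ * z) ^ 2)⁻¹) :=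
        (ofReal_integral_eq_lintegral_ofReal hint (ae_of_all _ fun z => by positivity)).symm
    _ = _ := by
        rw [integral_const_mul, Measure.integral_comp_mul_left (fun z : ℝ => (1 + z ^ 2)⁻¹) τ,
          integral_univ_inv_one_add_sq, abs_of_pos (inv_pos.2 hτ0), smul_eq_mul, mul_pow,
          ← Real.rpow_natCast (τ ^ (-β)), ← Real.rpow_mul hτ0.le]
        congr 1
        have : τ ^ (-(2 * β + 1)) = τ ^ (-β * ((2 : ℕ) : ℝ)) * τ⁻¹ := by
          rw [← Real.rpow_neg_one τ, ← Real.rpow_add hτ0]; congr 1; push_cast; ring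
        rw [this]
        ring

/-! ### Exponentially decaying characteristic functions -/

theorem exists_logDensity_le_rpow {p : ℝ → ℝ} {κ κ' : ℝ} (hκ : κ' ≤ κ) (hp : IsDensityOnPos p)
    (hzero : p =o[𝓝[>] 0] fun u : ℝ => u⁻¹ * |Real.log u| ^ (-κ))
    (htop : p =o[atTop] fun u : ℝ => u⁻¹ * |Real.log u| ^ (-κ)) :
    ∃ R : ℝ, 1 ≤ R ∧ ∀ u, R ≤ |u| → logDensity p u ≤ |u| ^ (-κ') := by
  have key : ∀ u : ℝ, ‖p (Real.exp u)‖
      ≤ 1 * ‖(Real.exp u)⁻¹ * |Real.log (Real.exp u)| ^ (-κ)‖ → 1 ≤ |u| →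
      logDensity p u ≤ |u| ^ (-κ') := by
    intro u hu h1
    have h0 : 0 ≤ |u| ^ (-κ) := Real.rpow_nonneg (abs_nonneg u) _
    rw [Real.log_exp, one_mul, norm_mul, Real.norm_of_nonneg h0, norm_inv,
      Real.norm_of_nonneg (Real.exp_pos u).le, Real.norm_of_nonneg (hp.nonneg _ (Real.exp_pos u))]
      at hu
    calc logDensity p u ≤ Real.exp u * ((Real.exp u)⁻¹ * |u| ^ (-κ)) :=
          mul_le_mul_of_nonneg_left hu (Real.exp_pos u).le
      _ = |u| ^ (-κ) := by
          rw [← mul_assoc, mul_inv_cancel₀ (Real.exp_pos u).ne', one_mul]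
      _ ≤ |u| ^ (-κ') := Real.rpow_le_rpow_of_exponent_le h1 (neg_le_neg hκ)
  have e1 := Real.tendsto_exp_atTop.eventually (htop.bound one_pos)
  have e2 := Real.tendsto_exp_atBot_nhdsGT.eventually (hzero.bound one_pos)
  obtain ⟨R₁, h₁⟩ := eventually_atTop.1 e1
  obtain ⟨R₂, h₂⟩ := eventually_atBot.1 e2
  refine ⟨max 1 (max R₁ (-R₂)), le_max_left _ _, fun u hu => ?_⟩
  have hu1 : 1 ≤ |u| := (le_max_left _ _).trans hu
  have hu2 : R₁ ≤ |u| := ((le_max_left _ _).trans (le_max_right _ _)).trans hu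
  have hu3 : -R₂ ≤ |u| := ((le_max_right _ _).trans (le_max_right _ _)).trans hu
  refine key u ?_ hu1
  rcases abs_cases u with ⟨h, _⟩ | ⟨h, _⟩
  · exact h₁ u (by linarith)
  · exact h₂ u (by linarith)

theorem integral_inv_one_add_sub_sq (z : ℝ) : ∫ u : ℝ, (1 + (z - u) ^ 2)⁻¹ = Real.pi := by
  rw [integral_sub_left_eq_self (fun u : ℝ => (1 + u ^ 2)⁻¹) volume z, integral_univ_inv_one_add_sq]

/-- The convolution of the density of `log Y` with a kernel of tail `u⁻²` inherits the tail
`|z|^(-κ)` of that density, `κ ≤ 2`: either `u` or `z - u` is at least `|z| / 2`. -/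
theorem IsDensityOnPos.exists_abs_logMixture_le {p : ℝ → ℝ} (hp : IsDensityOnPos p) {κ R : ℝ}
    (hκ0 : 0 ≤ κ) (hκ2 : κ ≤ 2) (hR : 1 ≤ R)
    (htail : ∀ u, R ≤ |u| → logDensity p u ≤ |u| ^ (-κ)) (ψ : SchwartzMap ℝ ℝ) :
    ∃ K : ℝ, 0 < K ∧ ∀ τ, 1 ≤ τ → ∀ z,
      |logMixture p (fun x => ψ (τ * x)) z| ≤ K * (1 + z ^ 2) ^ (-(κ / 2)) := by
  obtain ⟨K₀, hK₀, hψ⟩ := ψ.exists_abs_iteratedDeriv_le 0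
  simp only [iteratedDeriv_zero] at hψ
  set A := (1 + 4 * R ^ 2) ^ (κ / 2) with hA
  have hA0 : 0 < A := Real.rpow_pos_of_pos (by positivity) _
  set A' : ℝ := 8 ^ (κ / 2) with hA'
  have hA'0 : 0 < A' := Real.rpow_pos_of_pos (by norm_num) _
  refine ⟨K₀ * (A + (4 + A' * Real.pi)), by positivity, fun τ hτ z => ?_⟩
  have hz1 : (0 : ℝ) < 1 + z ^ 2 := by positivity
  have hzκ : 0 < (1 + z ^ 2) ^ (-(κ / 2)) := Real.rpow_pos_of_pos hz1 _
  have hkm : Measurable fun x : ℝ => (1 + x ^ 2)⁻¹ := by fun_prop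
  have hk1 : ∀ x : ℝ, |(1 + x ^ 2)⁻¹| ≤ 1 := fun x => by
    rw [abs_of_nonneg (by positivity)]
    exact inv_le_one_of_one_le₀ (by nlinarith [sq_nonneg x])
  have hki := hp.integrable_logMixture hkm hk1 z
  have hfirst : |logMixture p (fun x => ψ (τ * x)) z|
      ≤ K₀ * ∫ u, (1 + (z - u) ^ 2)⁻¹ * logDensity p u := by
    rw [← integral_const_mul]
    change ‖∫ u, ψ (τ * (z - u)) * logDensity p u‖ ≤ _
    refine norm_integral_le_of_norm_le (hki.const_mul K₀) (ae_of_all _ fun u => ?_)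
    rw [norm_mul, Real.norm_eq_abs, Real.norm_of_nonneg (hp.logDensity_nonneg u), ← mul_assoc]
    refine mul_le_mul_of_nonneg_right ((hψ _).trans ?_) (hp.logDensity_nonneg u)
    refine mul_le_mul_of_nonneg_left ?_ hK₀.le
    have h1 : (1 + (τ * (z - u)) ^ 2)⁻¹ ≤ (1 + (z - u) ^ 2)⁻¹ := by
      refine inv_anti₀ (by positivity) ?_
      rw [mul_pow]
      have := le_mul_of_one_le_left (sq_nonneg (z - u)) (one_le_pow₀ hτ (n := 2))
      linarith
    have h2 : (1 + (τ * (z - u)) ^ 2)⁻¹ ≤ 1 := (le_abs_self _).trans (hk1 _)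
    calc (1 + (τ * (z - u)) ^ 2)⁻¹ * (1 + (τ * (z - u)) ^ 2)⁻¹
        ≤ (1 + (z - u) ^ 2)⁻¹ * 1 := by gcongr
      _ = _ := mul_one _
  refine hfirst.trans ?_
  rw [mul_assoc]
  refine mul_le_mul_of_nonneg_left ?_ hK₀.le
  rw [add_mul]
  rcases le_or_gt |z| (2 * R) with hz | hz
  · have h1 : ∫ u, (1 + (z - u) ^ 2)⁻¹ * logDensity p u ≤ 1 := by
      refine (integral_mono hki hp.integrable_logDensity fun u => ?_).trans
        hp.integral_logDensity.le
      exact mul_le_of_le_one_left (hp.logDensity_nonneg u) ((le_abs_self _).trans (hk1 _))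
    have h2 : 1 ≤ A * (1 + z ^ 2) ^ (-(κ / 2)) := by
      rw [hA, Real.rpow_neg hz1.le, ← div_eq_mul_inv, one_le_div (Real.rpow_pos_of_pos hz1 _)]
      refine Real.rpow_le_rpow hz1.le ?_ (by linarith)
      have : z ^ 2 ≤ (2 * R) ^ 2 := sq_le_sq.2 (hz.trans (le_abs_self _))
      nlinarith
    have h3 : 0 ≤ (4 + A' * Real.pi) * (1 + z ^ 2) ^ (-(κ / 2)) := by positivity
    linarith
  · have hz2 : 1 < |z| / 2 := by linarith
    have hzz : 0 < |z| / 2 := by linarith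
    set t := (|z| / 2) ^ (-κ) with ht
    have ht0 : 0 < t := Real.rpow_pos_of_pos hzz _
    have hki' : Integrable fun u : ℝ => (1 + (z - u) ^ 2)⁻¹ :=
      integrable_inv_one_add_sq.comp_sub_left z
    have hpt : ∀ u, (1 + (z - u) ^ 2)⁻¹ * logDensity p u
        ≤ 4 * (1 + z ^ 2)⁻¹ * logDensity p u + t * (1 + (z - u) ^ 2)⁻¹ := by
      intro u
      have hq0 := hp.logDensity_nonneg u
      rcases le_or_gt |u| (|z| / 2) with hu | hu
      · have h1 : |z| / 2 ≤ |z - u| := by linarith [abs_sub_abs_le_abs_sub z u]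
        have h2 : (|z| / 2) ^ 2 ≤ (z - u) ^ 2 := by
          rw [← sq_abs (z - u)]; gcongr
        rw [div_pow, sq_abs] at h2
        have h3 : (1 + (z - u) ^ 2)⁻¹ ≤ 4 * (1 + z ^ 2)⁻¹ := by
          rw [← div_eq_mul_inv, inv_eq_one_div, div_le_div_iff₀ (by positivity) hz1]
          linarith
        have := mul_le_mul_of_nonneg_right h3 hq0
        have : 0 ≤ t * (1 + (z - u) ^ 2)⁻¹ := by positivity
        linarith
      · have h1 : logDensity p u ≤ t := by
          refine (htail u (by linarith)).trans ?_
          exact Real.rpow_le_rpow_of_nonpos hzz hu.le (by linarith)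
        have h2 : (0 : ℝ) ≤ (1 + (z - u) ^ 2)⁻¹ := by positivity
        have := mul_le_mul_of_nonneg_left h1 h2
        have : 0 ≤ 4 * (1 + z ^ 2)⁻¹ * logDensity p u := by positivity
        linarith
    have hint : ∫ u, (1 + (z - u) ^ 2)⁻¹ * logDensity p u ≤ 4 * (1 + z ^ 2)⁻¹ + t * Real.pi := by
      calc ∫ u, (1 + (z - u) ^ 2)⁻¹ * logDensity p u
          ≤ ∫ u, (4 * (1 + z ^ 2)⁻¹ * logDensity p u + t * (1 + (z - u) ^ 2)⁻¹) :=
            integral_mono hki ((hp.integrable_logDensity.const_mul _).add (hki'.const_mul t)) hpt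
        _ = _ := by
            rw [integral_add (hp.integrable_logDensity.const_mul _) (hki'.const_mul t),
              integral_const_mul, integral_const_mul, hp.integral_logDensity, mul_one,
              integral_inv_one_add_sub_sq]
    have hinv : (1 + z ^ 2)⁻¹ ≤ (1 + z ^ 2) ^ (-(κ / 2)) := by
      rw [← Real.rpow_neg_one]
      exact Real.rpow_le_rpow_of_exponent_le (by nlinarith [sq_nonneg z]) (by linarith)
    have htle : t ≤ A' * (1 + z ^ 2) ^ (-(κ / 2)) := by
      have h1 : (1 + z ^ 2) / 8 ≤ (|z| / 2) ^ 2 := by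
        have : 1 ≤ (|z| / 2) ^ 2 := one_le_pow₀ hz2.le
        rw [div_pow, sq_abs] at this ⊢
        linarith
      calc t = ((|z| / 2) ^ 2) ^ (-(κ / 2)) := by
            rw [ht, ← Real.rpow_natCast, ← Real.rpow_mul hzz.le]; congr 1; push_cast; ring
        _ ≤ ((1 + z ^ 2) / 8) ^ (-(κ / 2)) :=
            Real.rpow_le_rpow_of_nonpos (by positivity) h1 (by linarith)
        _ = A' * (1 + z ^ 2) ^ (-(κ / 2)) := by
            rw [Real.div_rpow hz1.le (by norm_num), hA',
              Real.rpow_neg (show (0 : ℝ) ≤ 8 by norm_num), div_inv_eq_mul, mul_comm]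
    have h5 : 0 ≤ A * (1 + z ^ 2) ^ (-(κ / 2)) := by positivity
    have h6 := mul_le_mul_of_nonneg_right htle Real.pi_pos.le
    linarith

theorem exists_norm_logCharFun_le_exp {p : ℝ → ℝ} {β γ β₁ : ℝ} (hβ : 0 < β) (hγ : 0 < γ)
    (hO : logCharFun p =O[cocompact ℝ] fun ξ : ℝ => |ξ| ^ β₁ * Real.exp (-(|ξ| ^ β) / γ)) :
    ∃ K X : ℝ, 0 < K ∧ ∀ x, X ≤ x →
      ‖logCharFun p x‖ ≤ K * Real.exp (-(x ^ β) / (2 * γ)) := by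
  obtain ⟨K, X, hK, h⟩ := exists_norm_le_of_isBigO_cocompact hO
  -- half of the exponential absorbs the power
  have hlim : Tendsto (fun x : ℝ => (x ^ β) ^ (β₁ / β) * Real.exp (-(1 / (2 * γ)) * x ^ β))
      atTop (𝓝 0) :=
    (tendsto_rpow_mul_exp_neg_mul_atTop_nhds_zero (β₁ / β) (1 / (2 * γ)) (by positivity)).comp
      (tendsto_rpow_atTop hβ)
  obtain ⟨X', hX'⟩ := eventually_atTop.1 (hlim.eventually (gt_mem_nhds one_pos))
  refine ⟨K, max 1 (max X X'), hK, fun x hx => ?_⟩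
  have hx1 : 1 ≤ x := (le_max_left _ _).trans hx
  have hx0 : 0 < x := by linarith
  have h1 := h x (((le_max_left _ _).trans (le_max_right _ _)).trans hx)
  have h2 := (hX' x (((le_max_right _ _).trans (le_max_right _ _)).trans hx)).le
  rw [abs_of_pos hx0, Real.norm_of_nonneg (by positivity)] at h1
  rw [← Real.rpow_mul hx0.le, mul_div_cancel₀ _ hβ.ne'] at h2
  refine h1.trans (mul_le_mul_of_nonneg_left ?_ hK.le)
  have hsplit : Real.exp (-(x ^ β) / γ)
      = Real.exp (-(1 / (2 * γ)) * x ^ β) * Real.exp (-(x ^ β) / (2 * γ)) := by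
    rw [← Real.exp_add]; congr 1; field_simp; ring
  rw [hsplit, ← mul_assoc]
  exact mul_le_of_le_one_left (Real.exp_pos _).le h2

theorem exists_norm_fourier_blurredFourier_le_exp {p : ℝ → ℝ} {β γ β₁ : ℝ} (hβ : 0 < β)
    (hγ : 0 < γ)
    (hO : logCharFun p =O[cocompact ℝ] fun ξ : ℝ => |ξ| ^ β₁ * Real.exp (-(|ξ| ^ β) / γ)) :
    ∃ K τ₀ : ℝ, 0 < K ∧ 1 ≤ τ₀ ∧ ∀ τ, τ₀ ≤ τ → ∀ y,
      ‖𝓕 (blurredFourier p τ) y‖ ≤ K * Real.exp (-(τ ^ β) / (2 * γ)) := by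
  obtain ⟨K, X, hK, h⟩ := exists_norm_logCharFun_le_exp hβ hγ hO
  refine ⟨K, max 1 X, hK, le_max_left _ _, fun τ hτ y => ?_⟩
  have hτ1 : 1 ≤ τ := (le_max_left _ _).trans hτ
  have hτX : X ≤ τ := (le_max_right _ _).trans hτ
  refine norm_fourier_le_of_support (fun v hv => ?_) (fun v hv => ?_) y
  · have hle : τ ≤ 2 * Real.pi * τ * v := by
      have h1 : 1 ≤ 2 * Real.pi := by linarith [Real.pi_gt_three]
      have h2 : 1 ≤ 2 * Real.pi * v := one_le_mul_of_one_le_of_one_le h1 hv.1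
      have := mul_le_mul_of_nonneg_right h2 (zero_le_one.trans hτ1)
      linarith
    rw [blurredFourier, norm_mul, Complex.norm_real, Real.norm_of_nonneg freqBump.nonneg]
    refine (mul_le_of_le_one_left (norm_nonneg _) freqBump.le_one).trans ?_
    refine (h _ (hτX.trans hle)).trans ?_
    gcongr
  · have hv' : v ≤ 1 ∨ 2 ≤ v := by
      rw [mem_Icc, not_and_or, not_le, not_le] at hv
      exact hv.imp le_of_lt le_of_lt
    rw [blurredFourier, freqBump_eq_zero hv', Complex.ofReal_zero, zero_mul]

/-- Interpolation between the exponentially small uniform bound and the polynomial tail: a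
positive fraction of the exponential decay survives. -/
theorem IsDensityOnPos.exists_blurredSize_le_exp {p : ℝ → ℝ} (hp : IsDensityOnPos p)
    {β γ β₁ κ : ℝ} (hβ : 0 < β) (hγ : 0 < γ) (hκ : 1 < κ)
    (hO : logCharFun p =O[cocompact ℝ] fun ξ : ℝ => |ξ| ^ β₁ * Real.exp (-(|ξ| ^ β) / γ))
    (hzero : p =o[𝓝[>] 0] fun u : ℝ => u⁻¹ * |Real.log u| ^ (-κ))
    (htop : p =o[atTop] fun u : ℝ => u⁻¹ * |Real.log u| ^ (-κ)) :
    ∃ s A δ τ₀ : ℝ, 1 / 2 < s ∧ s ≤ 1 ∧ 0 < A ∧ 0 < δ ∧ 1 ≤ τ₀ ∧ ∀ τ, τ₀ ≤ τ →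
      blurredSize p oscBump s τ ≤ ENNReal.ofReal (A * Real.exp (-(δ * τ ^ β))) := by
  set k := min κ 2 with hk
  have hk1 : 1 < k := lt_min hκ one_lt_two
  have hk2 : k ≤ 2 := min_le_right _ _
  obtain ⟨R, hR, htail⟩ := exists_logDensity_le_rpow (min_le_left κ 2) hp hzero htop
  obtain ⟨K, hK, hpoly⟩ := hp.exists_abs_logMixture_le (by linarith) hk2 hR htail oscBump
  obtain ⟨S, τ₀, hS, hτ₀, hexp⟩ := exists_norm_fourier_blurredFourier_le_exp hβ hγ hO
  set θ := (k - 1) / (2 * k) with hθ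
  have hθ0 : 0 < θ := div_pos (by linarith) (by linarith)
  have hθ1 : θ < 1 := by rw [hθ, div_lt_one (by linarith)]; linarith
  have hkθ : k * (1 - θ) = (k + 1) / 2 := by rw [hθ]; field_simp; ring
  set s := 1 / 2 + (k - 1) / 4 with hs
  have hint : Integrable fun z : ℝ => (1 + z ^ 2) ^ (-((k + 1) / 4)) :=
    integrable_one_add_sq_rpow (by linarith)
  have hIpos : 0 ≤ ∫ z : ℝ, (1 + z ^ 2) ^ (-((k + 1) / 4)) :=
    integral_nonneg fun z => Real.rpow_nonneg (by positivity) _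
  set I := ∫ z : ℝ, (1 + z ^ 2) ^ (-((k + 1) / 4)) with hI
  refine ⟨s, S ^ (2 * θ) * K ^ (2 * (1 - θ)) * (I + 1), θ / γ, τ₀, by linarith, by linarith,
    by positivity, by positivity, hτ₀, fun τ hτ => ?_⟩
  have hτ1 : 1 ≤ τ := hτ₀.trans hτ
  set x := S * Real.exp (-(τ ^ β) / (2 * γ)) with hx
  have hx0 : 0 < x := by positivity
  have hxθ : x ^ (2 * θ) = S ^ (2 * θ) * Real.exp (-(θ / γ * τ ^ β)) := by
    rw [hx, Real.mul_rpow hS.le (Real.exp_pos _).le, ← Real.exp_mul]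
    congr 2
    field_simp
  have hpt : ∀ z, logMixture p (fun x => oscBump (τ * x)) z ^ 2 * (1 + z ^ 2) ^ s
      ≤ x ^ (2 * θ) * K ^ (2 * (1 - θ)) * (1 + z ^ 2) ^ (-((k + 1) / 4)) := by
    intro z
    have hz1 : (0 : ℝ) < 1 + z ^ 2 := by positivity
    have b1 := (hp.abs_logMixture_oscBump_le τ z).trans (hexp τ hτ (τ * z))
    have b2 := hpoly τ hτ1 z
    set W := |logMixture p (fun x => oscBump (τ * x)) z| with hW
    have hW0 : 0 ≤ W := abs_nonneg _
    have hsplit : W ^ 2 = W ^ (2 * θ) * W ^ (2 * (1 - θ)) := by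
      rw [← Real.rpow_add_of_nonneg hW0 (by linarith) (by linarith), ← Real.rpow_natCast]
      congr 1; push_cast; ring
    have c1 : W ^ (2 * θ) ≤ x ^ (2 * θ) := Real.rpow_le_rpow hW0 b1 (by linarith)
    have c2 : W ^ (2 * (1 - θ)) ≤ K ^ (2 * (1 - θ)) * (1 + z ^ 2) ^ (-((k + 1) / 2)) := by
      refine (Real.rpow_le_rpow hW0 b2 (by linarith)).trans (le_of_eq ?_)
      rw [Real.mul_rpow hK.le (Real.rpow_nonneg hz1.le _), ← Real.rpow_mul hz1.le]
      congr 2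
      rw [← hkθ]
      ring
    rw [← sq_abs, ← hW, hsplit]
    calc W ^ (2 * θ) * W ^ (2 * (1 - θ)) * (1 + z ^ 2) ^ s
        ≤ x ^ (2 * θ) * (K ^ (2 * (1 - θ)) * (1 + z ^ 2) ^ (-((k + 1) / 2))) * (1 + z ^ 2) ^ s := by
          gcongr
      _ = x ^ (2 * θ) * K ^ (2 * (1 - θ))
            * ((1 + z ^ 2) ^ (-((k + 1) / 2)) * (1 + z ^ 2) ^ s) := by ring
      _ = _ := by
          rw [← Real.rpow_add hz1]
          congr 2
          rw [hs]; ring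
  calc blurredSize p oscBump s τ
      ≤ ∫⁻ z, ENNReal.ofReal (x ^ (2 * θ) * K ^ (2 * (1 - θ))
          * (1 + z ^ 2) ^ (-((k + 1) / 4))) :=
        lintegral_mono fun z => ENNReal.ofReal_le_ofReal (hpt z)
    _ = ENNReal.ofReal (x ^ (2 * θ) * K ^ (2 * (1 - θ)) * I) := by
        rw [← ofReal_integral_eq_lintegral_ofReal (hint.const_mul _)
          (ae_of_all _ fun z => by positivity), integral_const_mul]
    _ ≤ _ := by
        refine ENNReal.ofReal_le_ofReal ?_
        rw [hxθ]
        have : 0 ≤ S ^ (2 * θ) * K ^ (2 * (1 - θ)) * Real.exp (-(θ / γ * τ ^ β)) := by positivity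
        nlinarith

/-! ### Choice of the bandwidth -/

/-- If the vertices of the cube are indistinguishable from `n` observations for all bandwidths
`τ ≥ t n`, then the minimax risk is at least of the order `(t n)^(-2α)`. -/
theorem exists_eventually_le_minimaxRisk {a b : ℝ} (ha : 0 < a) (hab : a < b) {p : ℝ → ℝ}
    (hp : IsDensityOnPos p) {α C : ℝ} (hα : 0 < α) (hC : 0 < C) {s : ℝ} (hs : 1 / 2 < s)
    (hs1 : s ≤ 1) :
    ∃ K : ℝ, 0 < K ∧ ∀ t : ℕ → ℝ, Tendsto t atTop atTop →
      (∀ᶠ n : ℕ in atTop, ∀ τ, t n ≤ τ →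
        ENNReal.ofReal (K * τ ^ (-(2 * α))) * blurredSize p oscBump s τ ≤ (n : ℝ≥0∞)⁻¹) →
      ∃ c : ℝ, 0 < c ∧ ∀ᶠ n : ℕ in atTop, ENNReal.ofReal (c * t n ^ (-(2 * α)))
        ≤ minimaxRisk a b p (expTransform '' holderDensities α C) n := by
  obtain ⟨K, c, hK, hc, h⟩ := exists_le_minimaxRisk_of_blurredSize_le ha hab hp hα hC oscBump
    integral_oscBump oscBump_zero_ne_zero hs hs1
  refine ⟨K, hK, fun t ht hsmall => ⟨c * 2 ^ (-(2 * α)), by positivity, ?_⟩⟩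
  set L := Real.log b - Real.log a with hLdef
  have hL : 0 < L := sub_pos.2 (Real.log_lt_log ha hab)
  filter_upwards [hsmall, ht.eventually_ge_atTop (1 / L), eventually_gt_atTop 0] with n hn htn hn0
  have htpos : 0 < t n := (by positivity : (0 : ℝ) < 1 / L).trans_le htn
  have hm : 0 < ⌈L * t n⌉₊ := Nat.ceil_pos.2 (by positivity)
  set τ : ℝ := (⌈L * t n⌉₊ : ℝ) / L with hτ
  have hτ1 : t n ≤ τ := by
    rw [hτ, le_div_iff₀ hL, mul_comm]; exact Nat.le_ceil _
  have hτ2 : τ ≤ 2 * t n := by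
    have h1 := (Nat.ceil_lt_add_one (by positivity : 0 ≤ L * t n)).le
    have h2 : τ ≤ t n + 1 / L := by
      rw [hτ, div_le_iff₀ hL, add_mul, div_mul_cancel₀ _ hL.ne', mul_comm (t n)]
      exact h1
    linarith
  refine le_trans (ENNReal.ofReal_le_ofReal ?_) (h _ n hm hn0 τ hτ (hn τ hτ1))
  rw [mul_assoc, ← Real.mul_rpow zero_le_two htpos.le]
  refine mul_le_mul_of_nonneg_left ?_ hc.le
  exact Real.rpow_le_rpow_of_nonpos (htpos.trans_le hτ1) hτ2 (by linarith)

theorem exists_forall_ofReal_le_of_eventually {r : ℕ → ℝ} {ρ : ℕ → ℝ≥0∞} {c : ℝ} (hc : 0 < c)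
    (h : ∀ᶠ n in atTop, ENNReal.ofReal (c * r n) ≤ ρ n) :
    ∃ Cstar : ℝ, 0 < Cstar ∧ ∃ ε : ℕ → ℝ, Tendsto ε atTop (𝓝 0) ∧
      ∀ n, ENNReal.ofReal (Cstar * r n * (1 + ε n)) ≤ ρ n := by
  obtain ⟨N, hN⟩ := eventually_atTop.1 h
  refine ⟨c, hc, fun n => if N ≤ n then 0 else -1, ?_, fun n => ?_⟩
  · refine tendsto_const_nhds.congr' ?_
    filter_upwards [eventually_ge_atTop N] with n hn
    rw [if_pos hn]
  · by_cases hn : N ≤ n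
    · simp only [if_pos hn, add_zero, mul_one]; exact hN n hn
    · simp [if_neg hn]

theorem theorem8 (a b : ℝ) (ha : 0 < a) (hab : a < b)
    (p : ℝ → ℝ) (hp : IsDensityOnPos p)
    (α C : ℝ) (hα : 0 < α) (hC : 0 < C) :
    -- (a) polynomially decaying characteristic function
    (∀ β : ℝ, 0 < 2 * (α + β) + 1 →
      (∀ᶠ ξ in cocompact ℝ, ∀ j < 2, DifferentiableAt ℝ (iteratedDeriv j (logCharFun p)) ξ) →
      (∀ j ≤ 2, iteratedDeriv j (logCharFun p)
        =O[cocompact ℝ] fun ξ : ℝ => |ξ| ^ (-β - (j : ℝ))) →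
      ∃ Cstar : ℝ, 0 < Cstar ∧ ∃ ε : ℕ → ℝ, Tendsto ε atTop (𝓝 0) ∧ ∀ n : ℕ,
        ENNReal.ofReal (Cstar * (n : ℝ) ^ (-(2 * α) / (2 * (α + β) + 1)) * (1 + ε n))
          ≤ minimaxRisk a b p (expTransform '' holderDensities α C) n) ∧
    -- (b) exponentially decaying characteristic function
    (∀ β γ β₁ κ : ℝ, 0 < β → 0 < γ → 1 < κ →
      (logCharFun p =O[cocompact ℝ] fun ξ : ℝ => |ξ| ^ β₁ * Real.exp (-(|ξ| ^ β) / γ)) →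
      (p =o[𝓝[>] 0] fun u : ℝ => u⁻¹ * |Real.log u| ^ (-κ)) →
      (p =o[atTop] fun u : ℝ => u⁻¹ * |Real.log u| ^ (-κ)) →
      ∃ Cstar : ℝ, 0 < Cstar ∧ ∃ ε : ℕ → ℝ, Tendsto ε atTop (𝓝 0) ∧ ∀ n : ℕ,
        ENNReal.ofReal (Cstar * (Real.log n) ^ (-(2 * α) / β) * (1 + ε n))
          ≤ minimaxRisk a b p (expTransform '' holderDensities α C) n) := by
  refine ⟨fun β hd hdiff hO => ?_, fun β γ β₁ κ hβ hγ hκ hO hzero htop => ?_⟩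
  · obtain ⟨A, τ₀, hA, hτ₀, hsize⟩ := hp.exists_blurredSize_le_rpow hdiff hO
    obtain ⟨K, hK, h⟩ := exists_eventually_le_minimaxRisk ha hab hp hα hC
      (by norm_num : (1 / 2 : ℝ) < 1) le_rfl
    set d := 2 * (α + β) + 1 with hd'
    -- the bandwidth at which `K τ^(-2α) * A τ^(-(2β + 1))` equals `1 / n`
    set t : ℕ → ℝ := fun n => (K * A * n) ^ (1 / d) with ht
    have htlim : Tendsto t atTop atTop :=
      (tendsto_rpow_atTop (by positivity)).comp
        (tendsto_natCast_atTop_atTop.const_mul_atTop (by positivity))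
    obtain ⟨c, hc, hev⟩ := h t htlim (by
      filter_upwards [htlim.eventually_ge_atTop τ₀, eventually_gt_atTop 0] with n hn hn0 τ hτ
      have hτ0 : 0 < τ := by linarith
      have hn0' : (0 : ℝ) < n := by exact_mod_cast hn0
      refine (mul_le_mul_right (hsize τ (hn.trans hτ)) _).trans ?_
      rw [← ENNReal.ofReal_mul (by positivity), ← ENNReal.ofReal_natCast,
        ← ENNReal.ofReal_inv_of_pos hn0']
      refine ENNReal.ofReal_le_ofReal ?_
      have h1 : K * A * n ≤ τ ^ d := by
        calc K * A * n = t n ^ d := by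
              rw [ht, ← Real.rpow_mul (by positivity), one_div_mul_cancel hd.ne', Real.rpow_one]
          _ ≤ τ ^ d := Real.rpow_le_rpow (by positivity) hτ hd.le
      have h2 : K * τ ^ (-(2 * α)) * (A * τ ^ (-(2 * β + 1))) = K * A * (τ ^ d)⁻¹ := by
        rw [← Real.rpow_neg hτ0.le, show -d = -(2 * α) + -(2 * β + 1) by rw [hd']; ring,
          Real.rpow_add hτ0]
        ring
      rw [h2, ← div_eq_mul_inv, inv_eq_one_div, div_le_div_iff₀ (by positivity) hn0', one_mul]
      exact h1)
    refine exists_forall_ofReal_le_of_eventually (c := c * (K * A) ^ (-(2 * α) / d))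
      (by positivity) ?_
    filter_upwards [hev] with n hn
    refine le_trans (le_of_eq ?_) hn
    rw [ht, ← Real.rpow_mul (by positivity), mul_assoc, ← Real.mul_rpow (by positivity)
      (by positivity)]
    congr 3
    ring
  · obtain ⟨s, A, δ, τ₀, hs, hs1, hA, hδ, hτ₀, hsize⟩ :=
      hp.exists_blurredSize_le_exp hβ hγ hκ hO hzero htop
    obtain ⟨K, hK, h⟩ := exists_eventually_le_minimaxRisk ha hab hp hα hC hs hs1
    -- then `exp (-δ τ^β) ≤ n⁻²`, which leaves a factor `n⁻¹` for the constants
    set t : ℕ → ℝ := fun n => (2 / δ * Real.log n) ^ (1 / β) with ht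
    have hloglim : Tendsto (fun n : ℕ => Real.log n) atTop atTop :=
      Real.tendsto_log_atTop.comp tendsto_natCast_atTop_atTop
    have htlim : Tendsto t atTop atTop :=
      (tendsto_rpow_atTop (by positivity)).comp (hloglim.const_mul_atTop (by positivity))
    obtain ⟨c, hc, hev⟩ := h t htlim (by
      filter_upwards [htlim.eventually_ge_atTop τ₀, eventually_gt_atTop 0,
        tendsto_natCast_atTop_atTop.eventually_ge_atTop (K * A)] with n hn hn0 hnK τ hτ
      have hτ1 : 1 ≤ τ := (hτ₀.trans hn).trans hτ
      have hn0' : (0 : ℝ) < n := by exact_mod_cast hn0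
      have hlog : 0 ≤ Real.log n := Real.log_natCast_nonneg n
      refine (mul_le_mul_right (hsize τ (hn.trans hτ)) _).trans ?_
      rw [← ENNReal.ofReal_mul (by positivity), ← ENNReal.ofReal_natCast,
        ← ENNReal.ofReal_inv_of_pos hn0']
      refine ENNReal.ofReal_le_ofReal ?_
      have h1 : 2 / δ * Real.log n ≤ τ ^ β := by
        calc 2 / δ * Real.log n = t n ^ β := by
              rw [ht, ← Real.rpow_mul (by positivity), one_div_mul_cancel hβ.ne', Real.rpow_one]
          _ ≤ τ ^ β := Real.rpow_le_rpow (by positivity) hτ hβ.le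
      have h2 : Real.exp (-(δ * τ ^ β)) ≤ (n : ℝ)⁻¹ * (n : ℝ)⁻¹ := by
        rw [← Real.exp_log (inv_pos.2 hn0'), ← Real.exp_add, Real.log_inv]
        refine Real.exp_le_exp.2 ?_
        have := mul_le_mul_of_nonneg_left h1 hδ.le
        rw [← mul_assoc, mul_div_cancel₀ _ hδ.ne'] at this
        linarith
      have h3 : τ ^ (-(2 * α)) ≤ 1 := Real.rpow_le_one_of_one_le_of_nonpos hτ1 (by linarith)
      calc K * τ ^ (-(2 * α)) * (A * Real.exp (-(δ * τ ^ β)))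
          ≤ K * 1 * (A * ((n : ℝ)⁻¹ * (n : ℝ)⁻¹)) := by gcongr
        _ = K * A * (n : ℝ)⁻¹ * (n : ℝ)⁻¹ := by ring
        _ ≤ n * (n : ℝ)⁻¹ * (n : ℝ)⁻¹ := by gcongr
        _ = (n : ℝ)⁻¹ := by rw [mul_inv_cancel₀ hn0'.ne', one_mul])
    refine exists_forall_ofReal_le_of_eventually (c := c * (2 / δ) ^ (-(2 * α) / β))
      (by positivity) ?_
    filter_upwards [hev] with n hn
    have hlog : 0 ≤ Real.log n := Real.log_natCast_nonneg n
    refine le_trans (le_of_eq ?_) hn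
    rw [ht, ← Real.rpow_mul (by positivity), mul_assoc, ← Real.mul_rpow (by positivity) hlog]
    congr 3
    ring
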